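/- **Setting.** Let $(\mathcal C,\mathbb E,\mathfrak s)$ be an extriangulated category (Nakaoka–Palu). Suppose that whenever a composition $g\circ h$ of morphisms of $\mathcal C$ is a deflation, so is $g$ (the deflation half of condition (WIC); it holds e.g. in all abelian and all triangulated categories). $\mathbb E^i$ ($i\ge 1$) are the higher extension bifunctors of Gorsky–Nakaoka–Palu: $\mathbb E^1=\mathbb E$ and $\mathbb E^{i+1}(X,A)=\int^{M}\mathbb E(M,A)\otimes\mathbb E^{i}(X,M)$. Classes below are classes of objects of $\mathcal C$. **Notation.** For classes $\mathcal A,\mathcal B,\mathcal X,\mathcal Y,\mathcal T$: - $\mathcal A^{\perp}=\{C:\mathbb E^i(A,C)=0\ \forall i\ge 1,\ A\in\mathcal A\}$ and ${}^{\perp}\mathcal A=\{C:\mathbb E^i(C,A)=0\ \forall i\ge 1,\ A\in\mathcal A\}$. $\mathrm{smd}(\mathcal A)$ is the class of all direct summands of objects of $\mathcal A$. - $\mathrm{pd}_{\mathcal A}(C)=\min\{n\in\mathbb N:\mathbb E^k(C,A)=0\ \forall k>n,\ A\in\mathcal A\}$ ($\infty$ if there is no such $n$), $\mathrm{pd}_{\mathcal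 A}(\mathcal B)=\sup_{B\in\mathcal B}\mathrm{pd}_{\mathcal A}(B)$; dually $\mathrm{id}_{\mathcal A}(C)$, with $\mathbb E^k(A,C)$ in place of $\mathbb E^k(C,A)$, and $\mathrm{id}_{\mathcal A}(\mathcal B)$. - $\omega\subseteq\mathcal X$ is a *relative generator* (resp. *relative cogenerator*) in $\mathcal X$ if every $X\in\mathcal X$ admits an $\mathbb E$-triangle $X'\to W\to X\dashrightarrow$ (resp. $X\to W\to X'\dashrightarrow$) with $W\in\omega$, $X'\in\mathcal X$. - $\mathcal Y^{\vee}_{\mathcal X}$ is the class of objects $M$ having, for some $n\ge 0$, a finite $\mathcal Y_{\mathcal X}$-coresolution of length $n$: for $n=0$ this means that $M$ is isomorphic to an object of $\mathcal X\cap\mathcal Y$; for $n\ge 1$, that there is an $\mathbb E$-triangle $M\to Y_0\to N_0\dashrightarrow$ with $Y_0\in\mathcal Y$, $N_0\in\mathcal X$, where $N_0$ has a finite $\mathcal Y_{\mathcal X}$-coresolution of length $n-1$. - For $k\ge1$, $\mathrm{Fac}^{\mathcal X}_k(\mathcal T)$ is the class of objects $C$ for which there are $\mathbb E$-triangles $K_i\to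 T_i\to K_{i-1}\dashrightarrow$ ($1\le i\le k$) with $K_0=C$, $T_i\in\mathcal T\cap\mathcal X$ and $K_i\in\mathcal X$ for $1\le i\le k$. - $f:T'\to Z$ is a *$\mathcal T$-precover* if $T'\in\mathcal T$ and $\mathrm{Hom}(T'',f)$ is surjective for all $T''\in\mathcal T$. - The pair $(\mathcal A,\mathcal B)$ is *hereditary* if $\mathrm{id}_{\mathcal A}(\mathcal B)=0$. It is *$\mathcal X$-complete* if every $X\in\mathcal X$ admits $\mathbb E$-triangles $B\to A\to X\dashrightarrow$ and $X\to B'\to A'\dashrightarrow$ with $A,A'\in\mathcal A\cap\mathcal X$ and $B,B'\in\mathcal B\cap\mathcal X$. **Theorem.** Let $\mathcal X=\mathrm{smd}(\mathcal X)$ be closed under extensions, let $n\in\mathbb N$, and let $\mathcal T$ be a class such that - (T1) $\mathrm{pd}_{\mathcal X}(\mathcal T)\le n$; - (T2) $\mathcal T\cap\mathcal X\subseteq\mathcal T^{\perp}$; - (T3) there is a class $\omega\subseteq\mathcal T^{\vee}_{\mathcal X}$ which is a relative generator in $\mathcal X$; - (T4) there is a class $\alpha\subseteq\mathcal X^{\perp}\cap\mathcal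 T^{\perp}$ which is a relative cogenerator in $\mathcal X$; - (T5) every $Z\in\mathcal X\cap\mathcal T^{\perp}$ admits a $\mathcal T$-precover $T'\to Z$ with $T'\in\mathcal X$. Then: 1. If $\mathcal T=\mathrm{smd}(\mathcal T)$, then ${}^{\perp}(\mathcal T^{\perp}\cap\mathcal X)\cap\mathcal X={}^{\perp}(\mathcal T^{\perp})\cap\mathcal X=\mathcal T^{\vee}_{\mathcal X}\cap\mathcal X=(\mathcal T\cap\mathcal X)^{\vee}_{\mathcal X}\cap\mathcal X$. 2. $\mathcal T^{\perp}\cap\mathcal X=\mathrm{Fac}^{\mathcal X}_k(\mathcal T)\cap\mathcal X$ for all $k\ge\max\{1,\mathrm{pd}_{\mathcal X}(\mathcal T)\}$. 3. If $\mathcal T=\mathrm{smd}(\mathcal T)$, then the pair $({}^{\perp}(\mathcal T^{\perp}),\mathcal T^{\perp})$ is $\mathcal X$-complete and hereditary. -/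

import Mathlib

open CategoryTheory CategoryTheory.Limits

universe w w₁ w₂ v u

namespace Extri

/-! ## AbBifunctors with values in abelian groups -/

/-- Functors `Cᵒᵖ × C → Ab`, in curried form. -/
abbrev AbBifunctor (C : Type u) [Category.{v} C] : Type (max u v (w + 1)) :=
  Cᵒᵖ ⥤ C ⥤ AddCommGrpCat.{w}

namespace AbBifunctor

section Basic

variable {C : Type u} [Category.{v} C]

/-- The abelian group `F(X, A)`, contravariant in `X` and covariant in `A`. -/
abbrev val (F : AbBifunctor.{w} C) (X A : C) : Type w :=
  ((F.obj (Opposite.op X)).obj A : AddCommGrpCat.{w})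

/-- `a_* : F(X, A) → F(X, A')`. -/
def push (F : AbBifunctor.{w} C) {X A A' : C} (a : A ⟶ A') : F.val X A →+ F.val X A' :=
  ((F.obj (Opposite.op X)).map a).hom

/-- `c^* : F(X, A) → F(X', A)`. -/
def pull (F : AbBifunctor.{w} C) {X X' A : C} (c : X' ⟶ X) : F.val X A →+ F.val X' A :=
  ((F.map c.op).app A).hom

theorem push_id (F : AbBifunctor.{w} C) {X A : C} (δ : F.val X A) : F.push (𝟙 A) δ = δ := by
  simp [push]

theorem push_comp (F : AbBifunctor.{w} C) {X A A' A'' : C} (a : A ⟶ A') (a' : A' ⟶ A'')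
    (δ : F.val X A) : F.push (a ≫ a') δ = F.push a' (F.push a δ) := by
  simp [push]

theorem pull_id (F : AbBifunctor.{w} C) {X A : C} (δ : F.val X A) : F.pull (𝟙 X) δ = δ := by
  simp [pull]

theorem pull_comp (F : AbBifunctor.{w} C) {X X' X'' A : C} (c : X' ⟶ X) (c' : X'' ⟶ X')
    (δ : F.val X A) : F.pull (c' ≫ c) δ = F.pull c' (F.pull c δ) := by
  simp [pull]

theorem push_pull (F : AbBifunctor.{w} C) {X X' A A' : C} (c : X' ⟶ X) (a : A ⟶ A')
    (δ : F.val X A) : F.push a (F.pull c δ) = F.pull c (F.push a δ) := by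
  have h := congrArg (fun t => t.hom δ) ((F.map c.op).naturality a)
  simp_all [push, pull]

/-- The same bifunctor, with its values moved to a larger universe. -/
def lift (F : AbBifunctor.{w} C) : AbBifunctor.{max w w₁} C :=
  F ⋙ (Functor.whiskeringRight C _ _).obj AddCommGrpCat.uliftFunctor.{w₁, w}

end Basic

/-! ### The composition `F ⋄ G`

`(F ⋄ G)(X, A)` is the coend `∫^M F(M, A) ⊗ G(X, M)`: the abelian group generated by the symbols
`x ⊗ y` with `x ∈ F(M, A)`, `y ∈ G(X, M)`, `M` any object, subject to biadditivity and to
`(m^* x) ⊗ y = x ⊗ (m_* y)` for every morphism `m : M ⟶ M'`, `x ∈ F(M', A)`, `y ∈ G(X, M)`. -/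

section Diamond

variable {C : Type u} [Category.{v} C]

/-- The generators `x ⊗ y` of `(F ⋄ G)(X, A)`. -/
structure Gen (F : AbBifunctor.{w₁} C) (G : AbBifunctor.{w₂} C) (X A : C) :
    Type (max u w₁ w₂) where
  mid : C
  fst : F.val mid A
  snd : G.val X mid

/-- The elements of the free abelian group that are set equal to zero in `(F ⋄ G)(X, A)`. -/
inductive Rel (F : AbBifunctor.{w₁} C) (G : AbBifunctor.{w₂} C) (X A : C) :
    FreeAbelianGroup (Gen F G X A) → Prop
  | add_left {M : C} (x x' : F.val M A) (y : G.val X M) :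
      Rel F G X A (FreeAbelianGroup.of ⟨M, x + x', y⟩ -
        (FreeAbelianGroup.of ⟨M, x, y⟩ + FreeAbelianGroup.of ⟨M, x', y⟩))
  | add_right {M : C} (x : F.val M A) (y y' : G.val X M) :
      Rel F G X A (FreeAbelianGroup.of ⟨M, x, y + y'⟩ -
        (FreeAbelianGroup.of ⟨M, x, y⟩ + FreeAbelianGroup.of ⟨M, x, y'⟩))
  | balance {M M' : C} (m : M ⟶ M') (x : F.val M' A) (y : G.val X M) :
      Rel F G X A (FreeAbelianGroup.of ⟨M, F.pull m x, y⟩ -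
        FreeAbelianGroup.of ⟨M', x, G.push m y⟩)

/-- The subgroup of relations. -/
def relSubgroup (F : AbBifunctor.{w₁} C) (G : AbBifunctor.{w₂} C) (X A : C) :
    AddSubgroup (FreeAbelianGroup (Gen F G X A)) :=
  AddSubgroup.closure {z | Rel F G X A z}

/-- The abelian group `(F ⋄ G)(X, A)`. -/
abbrev DiamondVal (F : AbBifunctor.{w₁} C) (G : AbBifunctor.{w₂} C) (X A : C) :
    Type (max u w₁ w₂) :=
  FreeAbelianGroup (Gen F G X A) ⧸ relSubgroup F G X A

/-- The class of `x ⊗ y`. -/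
def tmul (F : AbBifunctor.{w₁} C) (G : AbBifunctor.{w₂} C) {X A M : C} (x : F.val M A)
    (y : G.val X M) : DiamondVal F G X A :=
  QuotientAddGroup.mk (FreeAbelianGroup.of ⟨M, x, y⟩)

/-- The action of `c : X' ⟶ X` and `a : A ⟶ A'` on generators: `x ⊗ y ↦ (a_* x) ⊗ (c^* y)`. -/
def Gen.map (F : AbBifunctor.{w₁} C) (G : AbBifunctor.{w₂} C) {X X' A A' : C} (c : X' ⟶ X)
    (a : A ⟶ A') (g : Gen F G X A) : Gen F G X' A' :=
  ⟨g.mid, F.push a g.fst, G.pull c g.snd⟩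

theorem relSubgroup_le (F : AbBifunctor.{w₁} C) (G : AbBifunctor.{w₂} C) {X X' A A' : C}
    (c : X' ⟶ X) (a : A ⟶ A') :
    relSubgroup F G X A ≤
      (relSubgroup F G X' A').comap (FreeAbelianGroup.map (Gen.map F G c a)) := by
  unfold relSubgroup
  rw [AddSubgroup.closure_le]
  rintro _ (⟨x, x', y⟩ | ⟨x, y, y'⟩ | ⟨m, x, y⟩)
  · apply AddSubgroup.subset_closure
    simpa [Gen.map, map_add] using Rel.add_left (F := F) (G := G) (F.push a x) (F.push a x') (G.pull c y)
  · apply AddSubgroup.subset_closure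
    simpa [Gen.map, map_add] using Rel.add_right (F := F) (G := G) (F.push a x) (G.pull c y) (G.pull c y')
  · apply AddSubgroup.subset_closure
    simpa [Gen.map, push_pull] using Rel.balance (F := F) (G := G) m (F.push a x) (G.pull c y)

/-- The action of a pair of morphisms on `F ⋄ G`. -/
def diamondMap (F : AbBifunctor.{w₁} C) (G : AbBifunctor.{w₂} C) {X X' A A' : C}
    (c : X' ⟶ X) (a : A ⟶ A') : DiamondVal F G X A →+ DiamondVal F G X' A' :=
  QuotientAddGroup.map _ _ (FreeAbelianGroup.map (Gen.map F G c a)) (relSubgroup_le F G c a)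

theorem diamondMap_tmul (F : AbBifunctor.{w₁} C) (G : AbBifunctor.{w₂} C) {X X' A A' M : C}
    (c : X' ⟶ X) (a : A ⟶ A') (x : F.val M A) (y : G.val X M) :
    diamondMap F G c a (tmul F G x y) = tmul F G (F.push a x) (G.pull c y) := by
  simp [diamondMap, tmul, Gen.map]

theorem diamond_hom_ext (F : AbBifunctor.{w₁} C) (G : AbBifunctor.{w₂} C) {X A : C}
    {H : Type*} [AddCommGroup H] {f g : DiamondVal F G X A →+ H}
    (h : ∀ (M : C) (x : F.val M A) (y : G.val X M), f (tmul F G x y) = g (tmul F G x y)) :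
    f = g := by
  apply QuotientAddGroup.addMonoidHom_ext
  apply FreeAbelianGroup.lift_ext
  rintro ⟨M, x, y⟩
  exact h M x y

/-- The bifunctor `F ⋄ G`. -/
def diamond (F : AbBifunctor.{w₁} C) (G : AbBifunctor.{w₂} C) : AbBifunctor.{max u w₁ w₂} C where
  obj X :=
    { obj := fun A => AddCommGrpCat.of (DiamondVal F G X.unop A)
      map := fun a => AddCommGrpCat.ofHom (diamondMap F G (𝟙 X.unop) a)
      map_id := fun A => by
        ext1
        apply diamond_hom_ext
        intro M x y
        simp [diamondMap_tmul, push_id, pull_id]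
      map_comp := fun a a' => by
        ext1
        apply diamond_hom_ext
        intro M x y
        simp [diamondMap_tmul, push_comp, pull_id] }
  map {X X'} c :=
    { app := fun A => AddCommGrpCat.ofHom (diamondMap F G c.unop (𝟙 A))
      naturality := fun A A' a => by
        ext1
        apply diamond_hom_ext
        intro M x y
        simp [diamondMap_tmul, push_id, pull_id] }
  map_id X := by
    ext1
    ext1 A
    ext1
    apply diamond_hom_ext
    intro M x y
    simp [diamondMap_tmul, push_id, pull_id]
  map_comp c c' := by
    ext1
    ext1 A
    ext1
    apply diamond_hom_ext
    intro M x y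
    simp [diamondMap_tmul, push_id, pull_comp]

end Diamond

end AbBifunctor

/-! ## Extriangulated categories -/

/-- A structure `(𝔼, 𝔰)` of an extriangulated category (Nakaoka–Palu) on an additive category. -/
structure ExtriangulatedStructure (C : Type u) [Category.{v} C] [Preadditive C]
    [HasZeroObject C] [HasBinaryBiproducts C] : Type (max u v (w + 1)) where
  /-- (ET1) the biadditive functor `𝔼 : Cᵒᵖ × C → Ab`; `E.val Z A` is `𝔼(Z, A)`. -/
  E : AbBifunctor.{w} C
  additive_right : ∀ X : Cᵒᵖ, (E.obj X).Additive
  additive_left : ∀ A : C, (E.flip.obj A).Additive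
  /-- `Triangle x y δ` says that the sequence `x, y` belongs to the class `𝔰(δ)`, that is, that
  `A --x--> B --y--> Z --δ-->` is an `𝔼`-triangle. -/
  Triangle : ∀ {A B Z : C}, (A ⟶ B) → (B ⟶ Z) → E.val Z A → Prop
  /- `𝔰(δ)` is one (nonempty) equivalence class of sequences, two sequences `A ⟶ B ⟶ Z` and
  `A ⟶ B' ⟶ Z` being equivalent if there is an isomorphism `B ≅ B'` compatible with the maps. -/
  exists_triangle : ∀ {A Z : C} (δ : E.val Z A),
    ∃ (B : C) (x : A ⟶ B) (y : B ⟶ Z), Triangle x y δ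
  triangle_unique : ∀ {A B B' Z : C} {x : A ⟶ B} {y : B ⟶ Z} {x' : A ⟶ B'} {y' : B' ⟶ Z}
    {δ : E.val Z A}, Triangle x y δ → Triangle x' y' δ →
    ∃ b : B ≅ B', x ≫ b.hom = x' ∧ b.hom ≫ y' = y
  triangle_of_iso : ∀ {A B B' Z : C} {x : A ⟶ B} {y : B ⟶ Z} {x' : A ⟶ B'} {y' : B' ⟶ Z}
    {δ : E.val Z A} (b : B ≅ B'), x ≫ b.hom = x' → b.hom ≫ y' = y →
    Triangle x y δ → Triangle x' y' δ
  /-- (ET2) `𝔰` is a realization: morphisms of extensions are realized. -/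
  realize_hom : ∀ {A B Z A' B' Z' : C} {x : A ⟶ B} {y : B ⟶ Z} {δ : E.val Z A}
    {x' : A' ⟶ B'} {y' : B' ⟶ Z'} {δ' : E.val Z' A'}, Triangle x y δ → Triangle x' y' δ' →
    ∀ (a : A ⟶ A') (c : Z ⟶ Z'), E.push a δ = E.pull c δ' →
    ∃ b : B ⟶ B', x ≫ b = a ≫ x' ∧ y ≫ c = b ≫ y'
  /-- (ET2) `𝔰(0)` is the split sequence. -/
  triangle_zero : ∀ A Z : C,
    Triangle (biprod.inl : A ⟶ A ⊞ Z) (biprod.snd : A ⊞ Z ⟶ Z) (0 : E.val Z A)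
  /-- (ET2) `𝔰(δ ⊕ δ') = 𝔰(δ) ⊕ 𝔰(δ')`. -/
  triangle_sum : ∀ {A B Z A' B' Z' : C} {x : A ⟶ B} {y : B ⟶ Z} {δ : E.val Z A}
    {x' : A' ⟶ B'} {y' : B' ⟶ Z'} {δ' : E.val Z' A'}, Triangle x y δ → Triangle x' y' δ' →
    Triangle (biprod.map x x') (biprod.map y y')
      (E.pull (biprod.fst : Z ⊞ Z' ⟶ Z) (E.push (biprod.inl : A ⟶ A ⊞ A') δ) +
        E.pull (biprod.snd : Z ⊞ Z' ⟶ Z') (E.push (biprod.inr : A' ⟶ A ⊞ A') δ'))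
  /-- (ET3) -/
  et3 : ∀ {A B Z A' B' Z' : C} {x : A ⟶ B} {y : B ⟶ Z} {δ : E.val Z A}
    {x' : A' ⟶ B'} {y' : B' ⟶ Z'} {δ' : E.val Z' A'}, Triangle x y δ → Triangle x' y' δ' →
    ∀ (a : A ⟶ A') (b : B ⟶ B'), x ≫ b = a ≫ x' →
    ∃ c : Z ⟶ Z', y ≫ c = b ≫ y' ∧ E.push a δ = E.pull c δ'
  /-- (ET3)ᵒᵖ -/
  et3op : ∀ {A B Z A' B' Z' : C} {x : A ⟶ B} {y : B ⟶ Z} {δ : E.val Z A}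
    {x' : A' ⟶ B'} {y' : B' ⟶ Z'} {δ' : E.val Z' A'}, Triangle x y δ → Triangle x' y' δ' →
    ∀ (b : B ⟶ B') (c : Z ⟶ Z'), y ≫ c = b ≫ y' →
    ∃ a : A ⟶ A', x ≫ b = a ≫ x' ∧ E.push a δ = E.pull c δ'
  /-- (ET4) -/
  et4 : ∀ {A B D Q F : C} {f : A ⟶ B} {f' : B ⟶ D} {δ : E.val D A}
    {g : B ⟶ Q} {g' : Q ⟶ F} {δ' : E.val F B}, Triangle f f' δ → Triangle g g' δ' →
    ∃ (P : C) (h' : Q ⟶ P) (d : D ⟶ P) (e : P ⟶ F) (δ'' : E.val P A),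
      Triangle (f ≫ g) h' δ'' ∧ g ≫ h' = f' ≫ d ∧ h' ≫ e = g' ∧
      Triangle d e (E.push f' δ') ∧ E.pull d δ'' = δ ∧ E.push f δ'' = E.pull e δ'
  /-- (ET4)ᵒᵖ -/
  et4op : ∀ {D A B F Q : C} {f' : D ⟶ A} {f : A ⟶ B} {δ : E.val B D}
    {g' : F ⟶ B} {g : B ⟶ Q} {δ' : E.val Q F}, Triangle f' f δ → Triangle g' g δ' →
    ∃ (P : C) (h' : P ⟶ A) (d : D ⟶ P) (e : P ⟶ F) (δ'' : E.val Q P),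
      Triangle h' (f ≫ g) δ'' ∧ d ≫ h' = f' ∧ h' ≫ f = e ≫ g' ∧
      Triangle d e (E.pull g' δ) ∧ E.push e δ'' = δ' ∧ E.push d δ = E.pull g δ''

namespace ExtriangulatedStructure

variable {C : Type u} [Category.{v} C] [Preadditive C] [HasZeroObject C] [HasBinaryBiproducts C]

/-- The higher extension bifunctors: `𝔼⁰ = Hom`, `𝔼¹ = 𝔼` and `𝔼ⁿ⁺¹ = 𝔼 ⋄ 𝔼ⁿ` for `n ≥ 1`
(Gorsky–Nakaoka–Palu). -/
noncomputable def extFunctor (ℰ : ExtriangulatedStructure.{w} C) :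
    ℕ → AbBifunctor.{max u v w} C
  | 0 => AbBifunctor.lift.{v, max u w} (preadditiveCoyoneda : Cᵒᵖ ⥤ C ⥤ AddCommGrpCat.{v})
  | 1 => AbBifunctor.lift.{w, max u v} ℰ.E
  | n + 2 => AbBifunctor.diamond ℰ.E (extFunctor ℰ (n + 1))

/-- `𝔼ᵏ(X, A) = 0`. -/
def ExtZero (ℰ : ExtriangulatedStructure.{w} C) (k : ℕ) (X A : C) : Prop :=
  Subsingleton ((ℰ.extFunctor k).val X A)

/-- `A ⟶ B ⟶ Z` is a conflation: `A ⟶ B ⟶ Z --δ-->` is an `𝔼`-triangle for some `δ`. -/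
def Conflation (ℰ : ExtriangulatedStructure.{w} C) {A B Z : C} (x : A ⟶ B) (y : B ⟶ Z) : Prop :=
  ∃ δ : ℰ.E.val Z A, ℰ.Triangle x y δ

/-- There is an `𝔼`-triangle `A ⟶ B ⟶ Z --->`. -/
def IsExtensionOf (ℰ : ExtriangulatedStructure.{w} C) (A B Z : C) : Prop :=
  ∃ (x : A ⟶ B) (y : B ⟶ Z), ℰ.Conflation x y

/-- `y` is a deflation. -/
def IsDeflation (ℰ : ExtriangulatedStructure.{w} C) {B Z : C} (y : B ⟶ Z) : Prop :=
  ∃ (A : C) (x : A ⟶ B), ℰ.Conflation x y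

/-- If a composition `B ⟶ B' ⟶ Z` is a deflation, so is its second factor `B' ⟶ Z`
(the half of the condition (WIC) of Nakaoka–Palu that concerns deflations). -/
def DeflationCancellation (ℰ : ExtriangulatedStructure.{w} C) : Prop :=
  ∀ ⦃B B' Z : C⦄ (h : B ⟶ B') (g : B' ⟶ Z), ℰ.IsDeflation (h ≫ g) → ℰ.IsDeflation g

/-! ### Classes of objects -/

/-- `𝒳^⊥ = {A | 𝔼ⁱ(X, A) = 0 for all i ≥ 1 and X ∈ 𝒳}`. -/
def rightPerp (ℰ : ExtriangulatedStructure.{w} C) (𝒳 : ObjectProperty C) : ObjectProperty C :=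
  fun A => ∀ i : ℕ, 1 ≤ i → ∀ X : C, 𝒳 X → ℰ.ExtZero i X A

/-- `^⊥𝒳 = {A | 𝔼ⁱ(A, X) = 0 for all i ≥ 1 and X ∈ 𝒳}`. -/
def leftPerp (ℰ : ExtriangulatedStructure.{w} C) (𝒳 : ObjectProperty C) : ObjectProperty C :=
  fun A => ∀ i : ℕ, 1 ≤ i → ∀ X : C, 𝒳 X → ℰ.ExtZero i A X

/-- `𝒳` is closed under extensions. -/
def ClosedUnderExtensions (ℰ : ExtriangulatedStructure.{w} C) (𝒳 : ObjectProperty C) : Prop :=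
  ∀ ⦃A B Z : C⦄, ℰ.IsExtensionOf A B Z → 𝒳 A → 𝒳 Z → 𝒳 B

/-- `pd_𝒜(M) = min {n ∈ ℕ | 𝔼ᵏ(M, -)|_𝒜 = 0 for all k > n}` (`⊤` if there is no such `n`). -/
noncomputable def projDimObj (ℰ : ExtriangulatedStructure.{w} C) (𝒜 : ObjectProperty C) (M : C) : ℕ∞ :=
  sInf {m : ℕ∞ | ∃ n : ℕ, m = n ∧ ∀ k : ℕ, n < k → ∀ A : C, 𝒜 A → ℰ.ExtZero k M A}

/-- `pd_𝒜(ℬ) = sup {pd_𝒜(B) | B ∈ ℬ}`. -/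
noncomputable def projDim (ℰ : ExtriangulatedStructure.{w} C) (𝒜 ℬ : ObjectProperty C) : ℕ∞ :=
  sSup {m : ℕ∞ | ∃ B : C, ℬ B ∧ m = ℰ.projDimObj 𝒜 B}

/-- `id_𝒜(M) = min {n ∈ ℕ | 𝔼ᵏ(-, M)|_𝒜 = 0 for all k > n}` (`⊤` if there is no such `n`). -/
noncomputable def injDimObj (ℰ : ExtriangulatedStructure.{w} C) (𝒜 : ObjectProperty C) (M : C) : ℕ∞ :=
  sInf {m : ℕ∞ | ∃ n : ℕ, m = n ∧ ∀ k : ℕ, n < k → ∀ A : C, 𝒜 A → ℰ.ExtZero k A M}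

/-- `id_𝒜(ℬ) = sup {id_𝒜(B) | B ∈ ℬ}`. -/
noncomputable def injDim (ℰ : ExtriangulatedStructure.{w} C) (𝒜 ℬ : ObjectProperty C) : ℕ∞ :=
  sSup {m : ℕ∞ | ∃ B : C, ℬ B ∧ m = ℰ.injDimObj 𝒜 B}

/-- `ω` is a relative generator in `𝒳`. -/
def IsRelativeGenerator (ℰ : ExtriangulatedStructure.{w} C) (ω 𝒳 : ObjectProperty C) : Prop :=
  ω ≤ 𝒳 ∧ ∀ X : C, 𝒳 X → ∃ X' W : C, 𝒳 X' ∧ ω W ∧ ℰ.IsExtensionOf X' W X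

/-- `α` is a relative cogenerator in `𝒳`. -/
def IsRelativeCogenerator (ℰ : ExtriangulatedStructure.{w} C) (α 𝒳 : ObjectProperty C) : Prop :=
  α ≤ 𝒳 ∧ ∀ X : C, 𝒳 X → ∃ W X' : C, α W ∧ 𝒳 X' ∧ ℰ.IsExtensionOf X W X'

/-- `M` has a finite `𝒴_𝒳`-coresolution `M ⟶ Y₀ ⟶ ⋯ ⟶ Yₙ` of length `n`: for `n = 0`, `M` is
(isomorphic to) an object of `𝒳 ∩ 𝒴`; for `n > 0`, there is an `𝔼`-triangle `M ⟶ Y₀ ⟶ N₀ --->`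
with `Y₀ ∈ 𝒴`, `N₀ ∈ 𝒳`, and `N₀` has a finite `𝒴_𝒳`-coresolution of length `n - 1`. -/
def HasFiniteCoresolution (ℰ : ExtriangulatedStructure.{w} C) (𝒴 𝒳 : ObjectProperty C) :
    ℕ → C → Prop
  | 0, M => (𝒳 ⊓ 𝒴).isoClosure M
  | n + 1, M => ∃ Y₀ N₀ : C, 𝒴 Y₀ ∧ 𝒳 N₀ ∧ ℰ.IsExtensionOf M Y₀ N₀ ∧
      HasFiniteCoresolution ℰ 𝒴 𝒳 n N₀

/-- The class `𝒴^∨_𝒳` of the objects that have a finite `𝒴_𝒳`-coresolution. -/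
def coresolved (ℰ : ExtriangulatedStructure.{w} C) (𝒴 𝒳 : ObjectProperty C) : ObjectProperty C :=
  fun M => ∃ n : ℕ, ℰ.HasFiniteCoresolution 𝒴 𝒳 n M

/-- `Fac^𝒳_n(𝒯)` for `n ≥ 1`: the objects `Z` for which there is
`K ⟶ Tₙ ⟶ ⋯ ⟶ T₁ ⟶ Z` composed of `𝔼`-triangles `Kᵢ ⟶ Tᵢ ⟶ Kᵢ₋₁ --->` (`1 ≤ i ≤ n`, `K₀ = Z`,
`Kₙ = K`) with `Tᵢ ∈ 𝒯 ∩ 𝒳` and `Kᵢ ∈ 𝒳`. (For `n = 0` the recursion starts from all objects.) -/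
def Fac (ℰ : ExtriangulatedStructure.{w} C) (𝒳 𝒯 : ObjectProperty C) : ℕ → ObjectProperty C
  | 0 => ⊤
  | n + 1 => fun Z => ∃ K T : C, 𝒳 K ∧ (𝒯 ⊓ 𝒳) T ∧ ℰ.IsExtensionOf K T Z ∧ Fac ℰ 𝒳 𝒯 n K

/-- The pair `(𝒜, ℬ)` is `𝒳`-hereditary. -/
def IsHereditaryRel (ℰ : ExtriangulatedStructure.{w} C) (𝒳 𝒜 ℬ : ObjectProperty C) : Prop :=
  ℰ.injDim (𝒜 ⊓ 𝒳) (ℬ ⊓ 𝒳) = 0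

/-- The pair `(𝒜, ℬ)` is hereditary. -/
def IsHereditary (ℰ : ExtriangulatedStructure.{w} C) (𝒜 ℬ : ObjectProperty C) : Prop :=
  ℰ.IsHereditaryRel ⊤ 𝒜 ℬ

/-- The pair `(𝒜, ℬ)` is left `𝒳`-complete. -/
def IsLeftComplete (ℰ : ExtriangulatedStructure.{w} C) (𝒳 𝒜 ℬ : ObjectProperty C) : Prop :=
  ∀ X : C, 𝒳 X → ∃ B A : C, (ℬ ⊓ 𝒳) B ∧ (𝒜 ⊓ 𝒳) A ∧ ℰ.IsExtensionOf B A X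

/-- The pair `(𝒜, ℬ)` is right `𝒳`-complete. -/
def IsRightComplete (ℰ : ExtriangulatedStructure.{w} C) (𝒳 𝒜 ℬ : ObjectProperty C) : Prop :=
  ∀ X : C, 𝒳 X → ∃ B A : C, (ℬ ⊓ 𝒳) B ∧ (𝒜 ⊓ 𝒳) A ∧ ℰ.IsExtensionOf X B A

/-- The pair `(𝒜, ℬ)` is `𝒳`-complete. -/
def IsComplete (ℰ : ExtriangulatedStructure.{w} C) (𝒳 𝒜 ℬ : ObjectProperty C) : Prop :=
  ℰ.IsLeftComplete 𝒳 𝒜 ℬ ∧ ℰ.IsRightComplete 𝒳 𝒜 ℬ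

end ExtriangulatedStructure

section Classes

variable {C : Type u} [Category.{v} C]

/-- `smd(ℳ)`: the direct summands of the objects of `ℳ`. -/
def smd [Preadditive C] [HasZeroObject C] [HasBinaryBiproducts C] (ℳ : ObjectProperty C) : ObjectProperty C :=
  fun A => ∃ M A' : C, ℳ M ∧ Nonempty (A ⊞ A' ≅ M)

/-- `f : T ⟶ Z` is a `𝒯`-precover. -/
def IsPrecover (𝒯 : ObjectProperty C) {T Z : C} (f : T ⟶ Z) : Prop :=
  𝒯 T ∧ ∀ T' : C, 𝒯 T' → Function.Surjective (fun h : T' ⟶ T => h ≫ f)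

end Classes

/-! ### The conditions (T1)–(T5) -/

namespace ExtriangulatedStructure

variable {C : Type u} [Category.{v} C] [Preadditive C] [HasZeroObject C] [HasBinaryBiproducts C]

/-- (T1) for a given `n`: `pd_𝒳(𝒯) ≤ n`. -/
def T1 (ℰ : ExtriangulatedStructure.{w} C) (n : ℕ) (𝒳 𝒯 : ObjectProperty C) : Prop :=
  ℰ.projDim 𝒳 𝒯 ≤ n

/-- (T2): `𝒯 ∩ 𝒳 ⊆ 𝒯^⊥`. -/
def T2 (ℰ : ExtriangulatedStructure.{w} C) (𝒳 𝒯 : ObjectProperty C) : Prop :=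
  𝒯 ⊓ 𝒳 ≤ ℰ.rightPerp 𝒯

/-- (T3): some `ω ⊆ 𝒯^∨_𝒳` is a relative generator in `𝒳`. -/
def T3 (ℰ : ExtriangulatedStructure.{w} C) (𝒳 𝒯 : ObjectProperty C) : Prop :=
  ∃ ω : ObjectProperty C, ω ≤ ℰ.coresolved 𝒯 𝒳 ∧ ℰ.IsRelativeGenerator ω 𝒳

/-- (T4): some `α ⊆ 𝒳^⊥ ∩ 𝒯^⊥` is a relative cogenerator in `𝒳`. -/
def T4 (ℰ : ExtriangulatedStructure.{w} C) (𝒳 𝒯 : ObjectProperty C) : Prop :=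
  ∃ α : ObjectProperty C, α ≤ ℰ.rightPerp 𝒳 ⊓ ℰ.rightPerp 𝒯 ∧ ℰ.IsRelativeCogenerator α 𝒳

/-- (T5): every `Z ∈ 𝒳 ∩ 𝒯^⊥` admits a `𝒯`-precover `T' ⟶ Z` with `T' ∈ 𝒳`. -/
def T5 (ℰ : ExtriangulatedStructure.{w} C) (𝒳 𝒯 : ObjectProperty C) : Prop :=
  ∀ Z : C, (𝒳 ⊓ ℰ.rightPerp 𝒯) Z → ∃ (T' : C) (f : T' ⟶ Z), 𝒳 T' ∧ IsPrecover 𝒯 f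

end ExtriangulatedStructure

end Extri

/-!
For additive `F` and `G` every element of `F ⋄ G` is a single tensor `x ⊗ y`, and `x ⊗ y = 0` is
witnessed by one morphism through which `x` and `y` are transported to zero. Together with (ET4)
this gives the long exact sequences of `𝔼ⁿ` in the second variable; in the first variable they
follow in the same way once `𝔼ⁿ⁺¹` is rewritten as `𝔼ⁿ ⋄ 𝔼` by associativity of `⋄`.

Let `Z ∈ 𝒯^⊥ ∩ 𝒳`. The `ω`-object mapping onto `Z` is coresolved by `𝒯`, so it factors through the
`𝒯`-precover of `Z`, which is therefore a deflation; its kernel is again in `𝒯^⊥ ∩ 𝒳`. Thus `𝒯 ∩ 𝒳`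
is a relative generator in `𝒯^⊥ ∩ 𝒳`, which gives the description by `Fac` through dimension
shifting. Induction on the `𝒯`-injective dimension of `X ∈ 𝒳` then yields conflations `X → B → A`
with `B ∈ 𝒯^⊥ ∩ 𝒳` and `A` coresolved by summands of objects of `𝒯 ∩ 𝒳`. If
`X ∈ ^⊥(𝒯^⊥ ∩ 𝒳)`, then so is `B`, and `B` is a summand of an object of `𝒯 ∩ 𝒳` since its cover
splits. The other half of completeness is Salce's pushout argument.
-/

universe w₃

namespace Extri

namespace AbBifunctor

section Additive

variable {C : Type u} [Category.{v} C] [Preadditive C]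

/-- Biadditive bifunctors, with additivity stated for the actions on elements. -/
class IsAdditive (F : AbBifunctor.{w} C) : Prop where
  push_add {X A A' : C} (f g : A ⟶ A') (δ : F.val X A) :
    F.push (f + g) δ = F.push f δ + F.push g δ
  pull_add {X X' A : C} (f g : X' ⟶ X) (δ : F.val X A) :
    F.pull (f + g) δ = F.pull f δ + F.pull g δ

variable (F : AbBifunctor.{w} C) [F.IsAdditive]

theorem push_add {X A A' : C} (f g : A ⟶ A') (δ : F.val X A) :
    F.push (f + g) δ = F.push f δ + F.push g δ :=
  IsAdditive.push_add f g δ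

theorem pull_add {X X' A : C} (f g : X' ⟶ X) (δ : F.val X A) :
    F.pull (f + g) δ = F.pull f δ + F.pull g δ :=
  IsAdditive.pull_add f g δ

theorem push_zero {X A A' : C} (δ : F.val X A) : F.push (0 : A ⟶ A') δ = 0 := by
  simpa using F.push_add (0 : A ⟶ A') 0 δ

theorem pull_zero {X X' A : C} (δ : F.val X A) : F.pull (0 : X' ⟶ X) δ = 0 := by
  simpa using F.pull_add (0 : X' ⟶ X) 0 δ

theorem push_sub {X A A' : C} (f g : A ⟶ A') (δ : F.val X A) :
    F.push (f - g) δ = F.push f δ - F.push g δ := by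
  rw [eq_sub_iff_add_eq, ← push_add, sub_add_cancel]

theorem pull_sub {X X' A : C} (f g : X' ⟶ X) (δ : F.val X A) :
    F.pull (f - g) δ = F.pull f δ - F.pull g δ := by
  rw [eq_sub_iff_add_eq, ← pull_add, sub_add_cancel]

instance : (lift.{w, w₁} F).IsAdditive where
  push_add f g δ := ULift.ext _ _ (F.push_add f g δ.down)
  pull_add f g δ := ULift.ext _ _ (F.pull_add f g δ.down)

end Additive

section Biproduct

variable {C : Type u} [Category.{v} C] [Preadditive C] [HasBinaryBiproducts C]
  (F : AbBifunctor.{w} C)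

/-- The element of `F(M ⊞ M', A)` with components `x₁` and `x₂`. -/
noncomputable def copair {M M' A : C} (x₁ : F.val M A) (x₂ : F.val M' A) : F.val (M ⊞ M') A :=
  F.pull biprod.fst x₁ + F.pull biprod.snd x₂

/-- The element of `F(X, M ⊞ M')` with components `y₁` and `y₂`. -/
noncomputable def pair {X M M' : C} (y₁ : F.val X M) (y₂ : F.val X M') : F.val X (M ⊞ M') :=
  F.push biprod.inl y₁ + F.push biprod.inr y₂

theorem push_desc_pair {X M M' N : C} (f : M ⟶ N) (f' : M' ⟶ N) (y : F.val X M)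
    (y' : F.val X M') : F.push (biprod.desc f f') (F.pair y y') = F.push f y + F.push f' y' := by
  simp [pair, ← push_comp]

variable [F.IsAdditive]

theorem pull_inl_copair {M M' A : C} (x : F.val M A) (x' : F.val M' A) :
    F.pull biprod.inl (F.copair x x') = x := by
  simp [copair, ← pull_comp, pull_id, pull_zero]

theorem pull_inr_copair {M M' A : C} (x : F.val M A) (x' : F.val M' A) :
    F.pull biprod.inr (F.copair x x') = x' := by
  simp [copair, ← pull_comp, pull_id, pull_zero]

theorem push_fst_pair {X M M' : C} (y : F.val X M) (y' : F.val X M') :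
    F.push biprod.fst (F.pair y y') = y := by
  simp [pair, ← push_comp, push_id, push_zero]

theorem push_snd_pair {X M M' : C} (y : F.val X M) (y' : F.val X M') :
    F.push biprod.snd (F.pair y y') = y' := by
  simp [pair, ← push_comp, push_id, push_zero]

theorem pull_desc_eq_zero {M M' N A : C} {f : M ⟶ N} {f' : M' ⟶ N} {x : F.val N A}
    (h : F.pull f x = 0) (h' : F.pull f' x = 0) : F.pull (biprod.desc f f') x = 0 := by
  rw [biprod.desc_eq, pull_add, pull_comp, pull_comp, h, h', map_zero, map_zero, add_zero]

end Biproduct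

section Tensor

variable {C : Type u} [Category.{v} C] {F : AbBifunctor.{w₁} C} {G : AbBifunctor.{w₂} C}

/-- The element `x ⊗ y` of `(F ⋄ G)(X, A)`: this is `tmul`, with values in the bifunctor
`diamond F G`, so that `push` and `pull` apply to it. -/
def tensor {X A M : C} (x : F.val M A) (y : G.val X M) : (diamond F G).val X A :=
  tmul F G x y

notation:70 x:70 " ⊙ " y:71 => tensor x y

theorem add_tensor {X A M : C} (x x' : F.val M A) (y : G.val X M) :
    (x + x') ⊙ y = x ⊙ y + x' ⊙ y := by
  rw [← sub_eq_zero]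
  exact (QuotientAddGroup.eq_zero_iff _).2 (AddSubgroup.subset_closure (Rel.add_left x x' y))

theorem tensor_add {X A M : C} (x : F.val M A) (y y' : G.val X M) :
    x ⊙ (y + y') = x ⊙ y + x ⊙ y' := by
  rw [← sub_eq_zero]
  exact (QuotientAddGroup.eq_zero_iff _).2 (AddSubgroup.subset_closure (Rel.add_right x y y'))

theorem pull_tensor_eq_tensor_push {X A M M' : C} (m : M ⟶ M') (x : F.val M' A)
    (y : G.val X M) : F.pull m x ⊙ y = x ⊙ G.push m y := by
  rw [← sub_eq_zero]
  exact (QuotientAddGroup.eq_zero_iff _).2 (AddSubgroup.subset_closure (Rel.balance m x y))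

theorem push_tensor {X A A' M : C} (a : A ⟶ A') (x : F.val M A) (y : G.val X M) :
    (diamond F G).push a (x ⊙ y) = F.push a x ⊙ y :=
  (diamondMap_tmul F G (𝟙 X) a x y).trans (by rw [pull_id]; rfl)

theorem pull_tensor {X X' A M : C} (c : X' ⟶ X) (x : F.val M A) (y : G.val X M) :
    (diamond F G).pull c (x ⊙ y) = x ⊙ G.pull c y :=
  (diamondMap_tmul F G c (𝟙 A) x y).trans (by rw [push_id]; rfl)

variable (F G) in
/-- `x ⊗ y` as a biadditive map. -/
def tensorHom (X A M : C) : F.val M A →+ G.val X M →+ (diamond F G).val X A :=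
  AddMonoidHom.mk' (fun x => AddMonoidHom.mk' (fun y => x ⊙ y) (tensor_add x))
    fun x x' => by ext y; exact add_tensor x x' y

theorem tensorHom_apply {X A M : C} (x : F.val M A) (y : G.val X M) :
    tensorHom F G X A M x y = x ⊙ y := rfl

theorem zero_tensor {X A M : C} (y : G.val X M) : (0 : F.val M A) ⊙ y = 0 := by
  simp [← tensorHom_apply]

theorem tensor_zero {X A M : C} (x : F.val M A) : x ⊙ (0 : G.val X M) = 0 := by
  simp [← tensorHom_apply]

theorem tensor_hom_ext {X A : C} {H : Type*} [AddCommGroup H]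
    {f g : (diamond F G).val X A →+ H}
    (h : ∀ (M : C) (x : F.val M A) (y : G.val X M), f (x ⊙ y) = g (x ⊙ y)) : f = g :=
  diamond_hom_ext F G h

/-- The homomorphism out of `(F ⋄ G)(X, A)` given by a balanced biadditive family. -/
def diamondLift {X A : C} {H : Type*} [AddCommGroup H]
    (φ : ∀ M : C, F.val M A →+ G.val X M →+ H)
    (hφ : ∀ ⦃M M' : C⦄ (m : M ⟶ M') (x : F.val M' A) (y : G.val X M),
      φ M (F.pull m x) y = φ M' x (G.push m y)) : (diamond F G).val X A →+ H :=
  QuotientAddGroup.lift (relSubgroup F G X A) (FreeAbelianGroup.lift fun g => φ g.mid g.fst g.snd)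
    (by
      rw [relSubgroup, AddSubgroup.closure_le]
      rintro _ (⟨x, x', y⟩ | ⟨x, y, y'⟩ | ⟨m, x, y⟩) <;> simp [hφ])

theorem diamondLift_tensor {X A M : C} {H : Type*} [AddCommGroup H]
    (φ : ∀ M : C, F.val M A →+ G.val X M →+ H)
    (hφ : ∀ ⦃M M' : C⦄ (m : M ⟶ M') (x : F.val M' A) (y : G.val X M),
      φ M (F.pull m x) y = φ M' x (G.push m y)) (x : F.val M A) (y : G.val X M) :
    diamondLift φ hφ (x ⊙ y) = φ M x y :=
  (QuotientAddGroup.lift_mk' _ _ _).trans (FreeAbelianGroup.lift_apply_of _ _)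

end Tensor

section AdditiveTensor

variable {C : Type u} [Category.{v} C] [Preadditive C] [HasBinaryBiproducts C]
  {F : AbBifunctor.{w₁} C} [F.IsAdditive] {G : AbBifunctor.{w₂} C}

theorem copair_tensor_pair {X A M M' : C} (x : F.val M A) (x' : F.val M' A) (y : G.val X M)
    (y' : G.val X M') : F.copair x x' ⊙ G.pair y y' = x ⊙ y + x' ⊙ y' := by
  rw [pair, tensor_add, ← pull_tensor_eq_tensor_push, ← pull_tensor_eq_tensor_push,
    pull_inl_copair, pull_inr_copair]

theorem exists_eq_tensor {X A : C} (ξ : (diamond F G).val X A) :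
    ∃ (M : C) (x : F.val M A) (y : G.val X M), ξ = x ⊙ y := by
  obtain ⟨z, rfl⟩ : ∃ z : FreeAbelianGroup (Gen F G X A),
    (QuotientAddGroup.mk z : DiamondVal F G X A) = ξ := QuotientAddGroup.mk_surjective _
  induction z using FreeAbelianGroup.induction_on with
  | zero => exact ⟨X, 0, 0, (zero_tensor _).symm⟩
  | of g => exact ⟨g.mid, g.fst, g.snd, rfl⟩
  | neg g _ => exact ⟨g.mid, -g.fst, g.snd, by simp only [← tensorHom_apply, map_neg]; rfl⟩
  | add z z' h h' =>
    obtain ⟨M, x, y, h⟩ := h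
    obtain ⟨M', x', y', h'⟩ := h'
    exact ⟨M ⊞ M', F.copair x x', G.pair y y',
      (congrArg₂ (· + ·) h h').trans (copair_tensor_pair x x' y y').symm⟩

instance [G.IsAdditive] : (diamond F G).IsAdditive where
  push_add f g δ := by
    obtain ⟨M, x, y, rfl⟩ := exists_eq_tensor δ
    simp only [push_tensor, push_add, add_tensor]
  pull_add f g δ := by
    obtain ⟨M, x, y, rfl⟩ := exists_eq_tensor δ
    simp only [pull_tensor, pull_add, tensor_add]

end AdditiveTensor

section Vanishing

variable {C : Type u} [Category.{v} C] [Preadditive C] [HasBinaryBiproducts C]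
  {F : AbBifunctor.{w₁} C} [F.IsAdditive]

/-- The images in `G(X, M)` under the morphisms `f : N ⟶ M` with `f^* x = 0`. If `y` lies in this
subgroup, then `x ⊗ y = 0`. -/
def pushedFromKernel (G : AbBifunctor.{w₂} C) (X : C) {A M : C} (x : F.val M A) :
    AddSubgroup (G.val X M) where
  carrier := {t | ∃ (N : C) (f : N ⟶ M) (s : G.val X N), F.pull f x = 0 ∧ G.push f s = t}
  zero_mem' := ⟨M, 0, 0, F.pull_zero x, map_zero _⟩
  neg_mem' := by
    rintro _ ⟨N, f, s, h, rfl⟩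
    exact ⟨N, f, -s, h, map_neg _ _⟩
  add_mem' := by
    rintro _ _ ⟨N, f, s, h, rfl⟩ ⟨N', f', s', h', rfl⟩
    exact ⟨N ⊞ N', biprod.desc f f', G.pair s s', F.pull_desc_eq_zero h h', G.push_desc_pair ..⟩

open scoped Classical in
/-- The homomorphism on formal sums that sends `(m^* x) ⊗ y` to the class of `m_* y` modulo
`pushedFromKernel`, and the generators that are not of this form to `0`. It does not vanish on all
relations of `F ⋄ G`, but every single relation is killed once `x` is replaced by a suitable
element that pulls back to `x`. -/
noncomputable def pushTest (G : AbBifunctor.{w₂} C) (X : C) {A M : C} (x : F.val M A) :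
    FreeAbelianGroup (Gen F G X A) →+ G.val X M ⧸ pushedFromKernel G X x :=
  FreeAbelianGroup.lift fun g => if h : ∃ m : g.mid ⟶ M, F.pull m x = g.fst then
    QuotientAddGroup.mk (G.push h.choose g.snd) else 0

variable {G : AbBifunctor.{w₂} C} [G.IsAdditive]

theorem pushTest_of {X A M N : C} {x : F.val M A} {x' : F.val N A} (m : N ⟶ M)
    (h : F.pull m x = x') (y : G.val X N) :
    pushTest G X x (FreeAbelianGroup.of ⟨N, x', y⟩) = QuotientAddGroup.mk (G.push m y) := by
  have h' : ∃ m : N ⟶ M, F.pull m x = x' := ⟨m, h⟩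
  simp only [pushTest, FreeAbelianGroup.lift_apply_of, dif_pos h']
  refine QuotientAddGroup.eq.2 ⟨N, m - h'.choose, y, ?_, ?_⟩
  · rw [pull_sub, h'.choose_spec, h, sub_self]
  · rw [push_sub, sub_eq_neg_add]

theorem pull_comp_eq_of_pull_eq_copair {A M N N' : C} {x₀ : F.val M A} {x : F.val N A}
    {x' : F.val N' A} {m : N ⊞ N' ⟶ M} (hm : F.pull m x₀ = F.copair x x') :
    F.pull (biprod.inl ≫ m) x₀ = x ∧ F.pull (biprod.inr ≫ m) x₀ = x' := by
  simp only [pull_comp, hm, pull_inl_copair, pull_inr_copair, and_self]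

theorem exists_pushTest_eq_zero {X A : C} {z : FreeAbelianGroup (Gen F G X A)}
    (hz : z ∈ relSubgroup F G X A) :
    ∃ (N : C) (x' : F.val N A), ∀ (M : C) (x : F.val M A) (m : N ⟶ M), F.pull m x = x' →
      pushTest G X x z = 0 := by
  induction hz using AddSubgroup.closure_induction with
  | mem z h =>
    rcases h with ⟨x, x', y⟩ | ⟨x, y, y'⟩ | ⟨k, x, y⟩
    · refine ⟨_, F.copair x x', fun M x₀ m hm => ?_⟩
      obtain ⟨h₁, h₂⟩ := pull_comp_eq_of_pull_eq_copair hm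
      rw [map_sub, map_add, pushTest_of _ h₁, pushTest_of _ h₂,
        pushTest_of (biprod.inl ≫ m + biprod.inr ≫ m) (by rw [pull_add, h₁, h₂]),
        push_add, QuotientAddGroup.mk_add, sub_self]
    · refine ⟨_, x, fun M x₀ m hm => ?_⟩
      rw [map_sub, map_add, pushTest_of _ hm, pushTest_of _ hm, pushTest_of _ hm, map_add,
        QuotientAddGroup.mk_add, sub_self]
    · refine ⟨_, x, fun M x₀ m hm => ?_⟩
      rw [map_sub, pushTest_of _ hm, pushTest_of (k ≫ m) (by rw [pull_comp, hm]), push_comp,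
        sub_self]
  | zero => exact ⟨X, 0, fun _ _ _ _ => map_zero _⟩
  | add z z' _ _ h h' =>
    obtain ⟨N, x, h⟩ := h
    obtain ⟨N', x', h'⟩ := h'
    refine ⟨_, F.copair x x', fun M x₀ m hm => ?_⟩
    obtain ⟨h₁, h₂⟩ := pull_comp_eq_of_pull_eq_copair hm
    rw [map_add, h M x₀ _ h₁, h' M x₀ _ h₂, add_zero]
  | neg z _ h =>
    obtain ⟨N, x, h⟩ := h
    exact ⟨N, x, fun M x₀ m hm => by rw [map_neg, h M x₀ m hm, neg_zero]⟩

theorem exists_pull_eq_of_tensor_eq_zero {X A M : C} {x : F.val M A} {y : G.val X M}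
    (h : x ⊙ y = 0) :
    ∃ (M' N : C) (m : M ⟶ M') (f : N ⟶ M') (x' : F.val M' A) (s : G.val X N),
      F.pull m x' = x ∧ F.pull f x' = 0 ∧ G.push f s = G.push m y := by
  obtain ⟨N, x', hx'⟩ := exists_pushTest_eq_zero ((QuotientAddGroup.eq_zero_iff _).1 h)
  have htest := hx' _ (F.copair x' x) biprod.inl (F.pull_inl_copair x' x)
  rw [pushTest_of biprod.inr (F.pull_inr_copair x' x)] at htest
  obtain ⟨L, f, s, hf, hs⟩ := (QuotientAddGroup.eq_zero_iff _).1 htest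
  exact ⟨_, L, biprod.inr, f, _, s, F.pull_inr_copair x' x, hf, hs⟩

theorem exists_push_eq_of_tensor_eq_zero {X A M : C} {x : F.val M A} {y : G.val X M}
    (h : x ⊙ y = 0) :
    ∃ (M' N : C) (p : N ⟶ M) (q : N ⟶ M') (x' : F.val M' A) (y' : G.val X N),
      G.push p y' = y ∧ G.push q y' = 0 ∧ F.pull q x' = F.pull p x := by
  obtain ⟨M', N, m, f, x', s, rfl, hf, hs⟩ := exists_pull_eq_of_tensor_eq_zero h
  refine ⟨M', M ⊞ N, biprod.fst, biprod.fst ≫ m - biprod.snd ≫ f, x', G.pair y s,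
    G.push_fst_pair y s, ?_, ?_⟩
  · rw [push_sub, push_comp, push_comp, push_fst_pair, push_snd_pair, hs, sub_self]
  · rw [pull_sub, pull_comp, pull_comp, hf, map_zero, sub_zero]

end Vanishing

section Assoc

variable {C : Type u} [Category.{v} C]

/-- A natural isomorphism of bifunctors from mutually inverse natural homomorphisms. -/
def isoMk {F G : AbBifunctor.{w} C} (φ : ∀ X A : C, F.val X A →+ G.val X A)
    (ψ : ∀ X A : C, G.val X A →+ F.val X A)
    (hψφ : ∀ X A, (ψ X A).comp (φ X A) = .id _) (hφψ : ∀ X A, (φ X A).comp (ψ X A) = .id _)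
    (hpush : ∀ {X A A' : C} (a : A ⟶ A'), (φ X A').comp (F.push a) = (G.push a).comp (φ X A))
    (hpull : ∀ {X X' A : C} (c : X' ⟶ X), (φ X' A).comp (F.pull c) = (G.pull c).comp (φ X A)) :
    F ≅ G :=
  NatIso.ofComponents
    (fun X => NatIso.ofComponents
      (fun A => ((φ X.unop A).toAddEquiv (ψ X.unop A) (hψφ _ _) (hφψ _ _)).toAddCommGrpIso)
      fun a => AddCommGrpCat.hom_ext (hpush a))
    fun c => NatTrans.ext (funext fun _ => AddCommGrpCat.hom_ext (hpull c.unop))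


/-- The values of `lift F` are the same groups in a larger universe. -/
def liftEquiv (F : AbBifunctor.{w} C) (X A : C) : (lift.{w, w₁} F).val X A ≃+ F.val X A :=
  AddEquiv.ulift

theorem liftEquiv_push (F : AbBifunctor.{w} C) {X A A' : C} (a : A ⟶ A')
    (δ : (lift.{w, w₁} F).val X A) :
    liftEquiv F X A' ((lift.{w, w₁} F).push a δ) = F.push a (liftEquiv F X A δ) := rfl

theorem liftEquiv_pull (F : AbBifunctor.{w} C) {X X' A : C} (c : X' ⟶ X)
    (δ : (lift.{w, w₁} F).val X A) :
    liftEquiv F X' A ((lift.{w, w₁} F).pull c δ) = F.pull c (liftEquiv F X A δ) := rfl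

theorem liftEquiv_symm_push (F : AbBifunctor.{w} C) {X A A' : C} (a : A ⟶ A') (δ : F.val X A) :
    (liftEquiv.{w, w₁} F X A').symm (F.push a δ) =
      (lift.{w, w₁} F).push a ((liftEquiv F X A).symm δ) := rfl

theorem liftEquiv_symm_pull (F : AbBifunctor.{w} C) {X X' A : C} (c : X' ⟶ X) (δ : F.val X A) :
    (liftEquiv.{w, w₁} F X' A).symm (F.pull c δ) =
      (lift.{w, w₁} F).pull c ((liftEquiv F X A).symm δ) := rfl

/-- The component at `(X, A)` of a natural transformation of bifunctors. -/
def appHom {F G : AbBifunctor.{w} C} (α : F ⟶ G) (X A : C) : F.val X A →+ G.val X A :=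
  ((α.app (Opposite.op X)).app A).hom

theorem appHom_push {F G : AbBifunctor.{w} C} (α : F ⟶ G) {X A A' : C} (a : A ⟶ A')
    (δ : F.val X A) : appHom α X A' (F.push a δ) = G.push a (appHom α X A δ) :=
  DFunLike.congr_fun (congrArg AddCommGrpCat.Hom.hom ((α.app (Opposite.op X)).naturality a)) δ

theorem appHom_pull {F G : AbBifunctor.{w} C} (α : F ⟶ G) {X X' A : C} (c : X' ⟶ X)
    (δ : F.val X A) : appHom α X' A (F.pull c δ) = G.pull c (appHom α X A δ) :=
  DFunLike.congr_fun
    (congrArg AddCommGrpCat.Hom.hom (NatTrans.congr_app (α.naturality c.op) A)) δ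

theorem appHom_inv_appHom_hom {F G : AbBifunctor.{w} C} (e : F ≅ G) {X A : C} (δ : F.val X A) :
    appHom e.inv X A (appHom e.hom X A δ) = δ := by
  simp only [appHom, ← AddCommGrpCat.comp_apply]
  simp

theorem appHom_hom_appHom_inv {F G : AbBifunctor.{w} C} (e : F ≅ G) {X A : C} (δ : G.val X A) :
    appHom e.hom X A (appHom e.inv X A δ) = δ :=
  appHom_inv_appHom_hom e.symm δ

/-- The homomorphism `x ⊗ y ↦ x ⊗ α(y)`. -/
def diamondMapRight (F : AbBifunctor.{w₁} C) {G H : AbBifunctor.{w₂} C} (α : G ⟶ H) (X A : C) :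
    (diamond F G).val X A →+ (diamond F H).val X A :=
  diamondLift (fun M => (tensorHom F H X A M).compl₂ (appHom α X M)) fun _ _ m x y => by
    simp [tensorHom_apply, appHom_push, pull_tensor_eq_tensor_push]

theorem diamondMapRight_tensor (F : AbBifunctor.{w₁} C) {G H : AbBifunctor.{w₂} C} (α : G ⟶ H)
    {X A M : C} (x : F.val M A) (y : G.val X M) :
    diamondMapRight F α X A (x ⊙ y) = x ⊙ appHom α X M y :=
  diamondLift_tensor ..

/-- The functor `F ⋄ -` on isomorphisms. -/
def diamondIsoRight (F : AbBifunctor.{w₁} C) {G H : AbBifunctor.{w₂} C} (e : G ≅ H) :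
    diamond F G ≅ diamond F H :=
  isoMk (diamondMapRight F e.hom) (diamondMapRight F e.inv)
    (fun _ _ => tensor_hom_ext fun M x y => by
      simp [diamondMapRight_tensor, appHom_inv_appHom_hom])
    (fun _ _ => tensor_hom_ext fun M x y => by
      simp [diamondMapRight_tensor, appHom_hom_appHom_inv])
    (fun a => tensor_hom_ext fun M x y => by simp [diamondMapRight_tensor, push_tensor])
    (fun c => tensor_hom_ext fun M x y => by
      simp [diamondMapRight_tensor, pull_tensor, appHom_pull])

/-- The homomorphism `x ⊗ y ↦ x ⊗ y` that moves the change of universe from `G` to `F`. -/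
def diamondLiftHom (F G : AbBifunctor.{w} C) (X A : C) :
    (diamond F (lift.{w, w₃} G)).val X A →+ (diamond (lift.{w, w₃} F) G).val X A :=
  diamondLift (fun M => ((tensorHom (lift.{w, w₃} F) G X A M).comp
    (liftEquiv F M A).symm.toAddMonoidHom).compl₂ (liftEquiv G X M).toAddMonoidHom)
    fun _ _ m x y => by
      simp [tensorHom_apply, liftEquiv_symm_pull, liftEquiv_push, pull_tensor_eq_tensor_push]

/-- The inverse of `diamondLiftHom`. -/
def diamondLiftInv (F G : AbBifunctor.{w} C) (X A : C) :
    (diamond (lift.{w, w₃} F) G).val X A →+ (diamond F (lift.{w, w₃} G)).val X A :=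
  diamondLift (fun M => ((tensorHom F (lift.{w, w₃} G) X A M).comp
    (liftEquiv F M A).toAddMonoidHom).compl₂ (liftEquiv G X M).symm.toAddMonoidHom)
    fun _ _ m x y => by
      simp [tensorHom_apply, liftEquiv_pull, liftEquiv_symm_push, pull_tensor_eq_tensor_push]

theorem diamondLiftHom_tensor {F G : AbBifunctor.{w} C} {X A M : C} (x : F.val M A)
    (y : (lift.{w, w₃} G).val X M) :
    diamondLiftHom F G X A (x ⊙ y) = (liftEquiv F M A).symm x ⊙ liftEquiv G X M y :=
  diamondLift_tensor ..

theorem diamondLiftInv_tensor {F G : AbBifunctor.{w} C} {X A M : C}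
    (x : (lift.{w, w₃} F).val M A) (y : G.val X M) :
    diamondLiftInv F G X A (x ⊙ y) = liftEquiv F M A x ⊙ (liftEquiv G X M).symm y :=
  diamondLift_tensor ..

/-- The change of universe may be moved from one factor of `F ⋄ G` to the other. -/
def diamondLiftIso (F G : AbBifunctor.{w} C) :
    diamond F (lift.{w, w₃} G) ≅ diamond (lift.{w, w₃} F) G :=
  isoMk (diamondLiftHom F G) (diamondLiftInv F G)
    (fun _ _ => tensor_hom_ext fun M x y => by
      simp [diamondLiftHom_tensor, diamondLiftInv_tensor])
    (fun _ _ => tensor_hom_ext fun M x y => by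
      simp [diamondLiftHom_tensor, diamondLiftInv_tensor])
    (fun a => tensor_hom_ext fun M x y => by
      simp [diamondLiftHom_tensor, push_tensor, liftEquiv_symm_push])
    (fun c => tensor_hom_ext fun M x y => by
      simp [diamondLiftHom_tensor, pull_tensor, liftEquiv_pull])

variable (F : AbBifunctor.{w₁} C) (G : AbBifunctor.{w₂} C) (H : AbBifunctor.{w₃} C)

/-- The homomorphism `y ⊗ z ↦ (x ⊗ y) ⊗ z` for a fixed `x`. -/
def assocLeft {X A M : C} (x : F.val M A) :
    (diamond G H).val X M →+ (diamond (diamond F G) H).val X A :=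
  diamondLift (fun N => (tensorHom (diamond F G) H X A N).comp (tensorHom F G N A M x))
    fun _ _ m y z => by
      simp only [AddMonoidHom.comp_apply, tensorHom_apply, ← pull_tensor,
        pull_tensor_eq_tensor_push]

/-- The homomorphism `x ⊗ y ↦ x ⊗ (y ⊗ z)` for a fixed `z`. -/
def assocRight {X A N : C} (z : H.val X N) :
    (diamond F G).val N A →+ (diamond F (diamond G H)).val X A :=
  diamondLift (fun M => (tensorHom F (diamond G H) X A M).compl₂ ((tensorHom G H X M N).flip z))
    fun _ _ m x y => by
      simp only [AddMonoidHom.compl₂_apply, AddMonoidHom.flip_apply, tensorHom_apply,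
        ← push_tensor, pull_tensor_eq_tensor_push]

variable {F G H}

theorem assocLeft_tensor {X A M N : C} (x : F.val M A) (y : G.val N M) (z : H.val X N) :
    assocLeft F G H x (y ⊙ z) = x ⊙ y ⊙ z :=
  diamondLift_tensor ..

theorem assocRight_tensor {X A M N : C} (x : F.val M A) (y : G.val N M) (z : H.val X N) :
    assocRight F G H z (x ⊙ y) = x ⊙ (y ⊙ z) :=
  diamondLift_tensor ..

theorem tensor_tensor_hom_ext_right {X A : C} {L : Type*} [AddCommGroup L]
    {f g : (diamond F (diamond G H)).val X A →+ L}
    (h : ∀ (M N : C) (x : F.val M A) (y : G.val N M) (z : H.val X N),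
      f (x ⊙ (y ⊙ z)) = g (x ⊙ (y ⊙ z))) : f = g :=
  tensor_hom_ext fun M x t => DFunLike.congr_fun
    (f := f.comp (tensorHom F (diamond G H) X A M x))
    (g := g.comp (tensorHom F (diamond G H) X A M x))
    (tensor_hom_ext fun N y z => h M N x y z) t

theorem tensor_tensor_hom_ext_left {X A : C} {L : Type*} [AddCommGroup L]
    {f g : (diamond (diamond F G) H).val X A →+ L}
    (h : ∀ (M N : C) (x : F.val M A) (y : G.val N M) (z : H.val X N),
      f (x ⊙ y ⊙ z) = g (x ⊙ y ⊙ z)) : f = g :=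
  tensor_hom_ext fun N t z => DFunLike.congr_fun
    (f := f.comp ((tensorHom (diamond F G) H X A N).flip z))
    (g := g.comp ((tensorHom (diamond F G) H X A N).flip z))
    (tensor_hom_ext fun M x y => h M N x y z) t

variable (F G H)

/-- The homomorphism `x ⊗ (y ⊗ z) ↦ (x ⊗ y) ⊗ z`. -/
def assocHom (X A : C) :
    (diamond F (diamond G H)).val X A →+ (diamond (diamond F G) H).val X A :=
  diamondLift
    (fun M => AddMonoidHom.mk' (assocLeft F G H) fun x x' => tensor_hom_ext fun N y z => by
      simp only [AddMonoidHom.add_apply, assocLeft_tensor, add_tensor])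
    fun M M' m x => DFunLike.congr_fun (f := assocLeft F G H (F.pull m x))
      (g := (assocLeft F G H x).comp ((diamond G H).push m)) <| tensor_hom_ext fun N y z => by
        simp only [AddMonoidHom.comp_apply, push_tensor, assocLeft_tensor,
          pull_tensor_eq_tensor_push]

/-- The homomorphism `(x ⊗ y) ⊗ z ↦ x ⊗ (y ⊗ z)`. -/
def assocInv (X A : C) :
    (diamond (diamond F G) H).val X A →+ (diamond F (diamond G H)).val X A :=
  diamondLift
    (fun N => (AddMonoidHom.mk' (assocRight F G H) fun z z' => tensor_hom_ext fun M x y => by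
      simp only [AddMonoidHom.add_apply, assocRight_tensor, tensor_add]).flip)
    fun N N' m t z => DFunLike.congr_fun (f := (assocRight F G H z).comp ((diamond F G).pull m))
      (g := assocRight F G H (H.push m z)) (tensor_hom_ext fun M x y => by
        simp only [AddMonoidHom.comp_apply, pull_tensor, assocRight_tensor,
          pull_tensor_eq_tensor_push]) t

variable {F G H}

theorem assocHom_tensor {X A M N : C} (x : F.val M A) (y : G.val N M) (z : H.val X N) :
    assocHom F G H X A (x ⊙ (y ⊙ z)) = x ⊙ y ⊙ z :=
  (diamondLift_tensor ..).trans (assocLeft_tensor ..)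

theorem assocInv_tensor {X A M N : C} (x : F.val M A) (y : G.val N M) (z : H.val X N) :
    assocInv F G H X A (x ⊙ y ⊙ z) = x ⊙ (y ⊙ z) :=
  (diamondLift_tensor ..).trans (assocRight_tensor ..)

variable (F G H)

/-- The associativity isomorphism of `⋄`. -/
def diamondAssoc : diamond F (diamond G H) ≅ diamond (diamond F G) H :=
  isoMk (assocHom F G H) (assocInv F G H)
    (fun _ _ => tensor_tensor_hom_ext_right fun M N x y z => by
      simp [assocHom_tensor, assocInv_tensor])
    (fun _ _ => tensor_tensor_hom_ext_left fun M N x y z => by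
      simp [assocHom_tensor, assocInv_tensor])
    (fun a => tensor_tensor_hom_ext_right fun M N x y z => by
      simp [push_tensor, assocHom_tensor])
    (fun c => tensor_tensor_hom_ext_right fun M N x y z => by
      simp [pull_tensor, assocHom_tensor])

end Assoc

end AbBifunctor

/-! ### Half-exactness of the higher extension functors -/

namespace ExtriangulatedStructure

open AbBifunctor

variable {C : Type u} [Category.{v} C] [Preadditive C] [HasZeroObject C] [HasBinaryBiproducts C]
  {ℰ : ExtriangulatedStructure.{w} C}

section Triangle

instance : ℰ.E.IsAdditive where
  push_add {X A A'} f g δ := by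
    have := ℰ.additive_right (Opposite.op X)
    have h := (ℰ.E.obj (Opposite.op X)).map_add (f := f) (g := g)
    simp [push, h]
  pull_add {X X' A} f g δ := by
    have := ℰ.additive_left A
    have h := (ℰ.E.flip.obj A).map_add (f := f.op) (g := g.op)
    simp only [Functor.flip_obj_map] at h
    simp [pull, op_add, h]

open scoped ZeroObject

theorem triangle_id_zero (A : C) : ℰ.Triangle (𝟙 A) (0 : A ⟶ (0 : C)) 0 :=
  ℰ.triangle_of_iso ⟨biprod.fst, biprod.inl, by ext; simp, by simp⟩
    (by simp) ((isZero_zero C).eq_of_tgt _ _) (ℰ.triangle_zero A 0)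

theorem triangle_zero_id (Z : C) : ℰ.Triangle (0 : (0 : C) ⟶ Z) (𝟙 Z) 0 :=
  ℰ.triangle_of_iso ⟨biprod.snd, biprod.inr, by ext; simp, by simp⟩
    (by simp) (by simp) (ℰ.triangle_zero 0 Z)

theorem triangle_inr_fst (A Z : C) :
    ℰ.Triangle (biprod.inr : Z ⟶ A ⊞ Z) (biprod.fst : A ⊞ Z ⟶ A) 0 :=
  ℰ.triangle_of_iso (biprod.braiding Z A) (by ext <;> simp) (by simp) (ℰ.triangle_zero Z A)

namespace Triangle

variable {A B Z : C} {x : A ⟶ B} {y : B ⟶ Z} {δ : ℰ.E.val Z A}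

theorem comp_zero (t : ℰ.Triangle x y δ) : x ≫ y = 0 := by
  obtain ⟨c, hc, -⟩ := ℰ.et3 (triangle_id_zero A) t (𝟙 A) x (by simp)
  simpa using hc.symm

theorem pull_eq_zero (t : ℰ.Triangle x y δ) : ℰ.E.pull y δ = 0 := by
  obtain ⟨a, -, ha⟩ := ℰ.et3op (triangle_zero_id B) t (𝟙 B) y (by simp)
  simpa using ha.symm

theorem exists_desc_of_comp_eq_zero (t : ℰ.Triangle x y δ) {X : C} (f : B ⟶ X)
    (h : x ≫ f = 0) : ∃ g : Z ⟶ X, y ≫ g = f := by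
  obtain ⟨c, hc, -⟩ := ℰ.et3 t (triangle_zero_id X) 0 f (by simp [h])
  exact ⟨c, by simpa using hc⟩

theorem exists_lift (t : ℰ.Triangle x y δ) {X : C} (f : X ⟶ Z) (h : ℰ.E.pull f δ = 0) :
    ∃ g : X ⟶ B, g ≫ y = f := by
  obtain ⟨b, -, hb⟩ := ℰ.realize_hom (ℰ.triangle_zero A X) t (𝟙 A) f (by simp [h])
  exact ⟨biprod.inr ≫ b, by simp [← hb]⟩

theorem exists_desc (t : ℰ.Triangle x y δ) {X : C} (f : A ⟶ X) (h : ℰ.E.push f δ = 0) :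
    ∃ g : B ⟶ X, x ≫ g = f := by
  obtain ⟨b, hb, -⟩ := ℰ.realize_hom t (ℰ.triangle_zero X Z) f (𝟙 Z) (by simp [h])
  exact ⟨b ≫ biprod.fst, by simp [reassoc_of% hb]⟩

theorem exists_pull_eq (t : ℰ.Triangle x y δ) {X : C} (ε : ℰ.E.val X A)
    (h : ℰ.E.push x ε = 0) : ∃ f : X ⟶ Z, ℰ.E.pull f δ = ε := by
  obtain ⟨D, i, p, s⟩ := ℰ.exists_triangle ε
  obtain ⟨g, hg⟩ := s.exists_desc x h
  obtain ⟨c, -, hc⟩ := ℰ.et3 s t (𝟙 A) g (by simp [hg])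
  exact ⟨c, by rw [← hc, push_id]⟩

theorem exists_push_inflation_eq (t : ℰ.Triangle x y δ) {X : C} (ε : ℰ.E.val X B)
    (h : ℰ.E.push y ε = 0) : ∃ ε' : ℰ.E.val X A, ℰ.E.push x ε' = ε := by
  obtain ⟨D, g, g', s⟩ := ℰ.exists_triangle ε
  obtain ⟨P, h', d, e, δ'', -, -, -, t', -, he⟩ := ℰ.et4 t s
  obtain ⟨r, hr⟩ := t'.exists_lift (𝟙 X) (by simp [h])
  exact ⟨ℰ.E.pull r δ'', by rw [push_pull, he, ← pull_comp, hr, pull_id]⟩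

theorem exists_pull_deflation_eq (t : ℰ.Triangle x y δ) {X : C} (ε : ℰ.E.val B X)
    (h : ℰ.E.pull x ε = 0) : ∃ ε' : ℰ.E.val Z X, ℰ.E.pull y ε' = ε := by
  obtain ⟨D, g, g', s⟩ := ℰ.exists_triangle ε
  obtain ⟨P, h', d, e, δ'', -, -, -, t', -, he⟩ := ℰ.et4op s t
  obtain ⟨r, hr⟩ := t'.exists_desc (𝟙 X) (by simp [h])
  exact ⟨ℰ.E.push r δ'', by rw [← push_pull, ← he, ← push_comp, hr, push_id]⟩

theorem isIso_of_comp_eq (t : ℰ.Triangle x y δ) {b : B ⟶ B} (hx : x ≫ b = x)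
    (hy : b ≫ y = y) : IsIso b := by
  -- `b - 𝟙` factors through `y` and is killed by `y`, so its square is zero.
  obtain ⟨ψ, hψ⟩ := t.exists_desc_of_comp_eq_zero (b - 𝟙 B) (by simp [hx])
  obtain rfl : b = 𝟙 B + y ≫ ψ := by rw [hψ, add_sub_cancel]
  have hsq : y ≫ ψ ≫ y = 0 := by simpa using hy
  exact ⟨𝟙 B - y ≫ ψ, by simp [reassoc_of% hsq], by simp [reassoc_of% hsq]⟩

theorem of_iso (t : ℰ.Triangle x y δ) {A' Z' : C} (a : A ≅ A') (c : Z ≅ Z') :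
    ℰ.Triangle (a.inv ≫ x) (y ≫ c.hom) (ℰ.E.pull c.inv (ℰ.E.push a.hom δ)) := by
  obtain ⟨B', x', y', t'⟩ := ℰ.exists_triangle (ℰ.E.pull c.inv (ℰ.E.push a.hom δ))
  obtain ⟨b, hx, hy⟩ := ℰ.realize_hom t t' a.hom c.hom (by simp [← pull_comp, pull_id])
  obtain ⟨b', hx', hy'⟩ := ℰ.realize_hom t' t a.inv c.inv
    (by simp [push_pull, ← push_comp, push_id])
  have : IsIso (b ≫ b') :=
    t.isIso_of_comp_eq (by simp [reassoc_of% hx, hx']) (by simp [← hy', ← reassoc_of% hy])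
  have : IsIso (b' ≫ b) :=
    t'.isIso_of_comp_eq (by simp [reassoc_of% hx', hx]) (by simp [← hy, ← reassoc_of% hy'])
  have : Epi b := epi_of_epi b' b
  have : IsSplitMono b := .mk' ⟨b' ≫ inv (b ≫ b'), by simp [← Category.assoc]⟩
  have : IsIso b := isIso_of_epi_of_isSplitMono b
  exact ℰ.triangle_of_iso (asIso b).symm (by simp [← cancel_mono b, hx]) (by simp [hy]) t'

end Triangle

/-- (ET4) with a prescribed third triangle (Nakaoka–Palu, Lemma 3.14). -/
theorem et4_of_triangle {A B D Q F P : C} {f : A ⟶ B} {f' : B ⟶ D} {δ : ℰ.E.val D A}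
    {g : B ⟶ Q} {g' : Q ⟶ F} {δ' : ℰ.E.val F B} {d : D ⟶ P} {e : P ⟶ F}
    (s : ℰ.Triangle f f' δ) (t : ℰ.Triangle g g' δ') (r : ℰ.Triangle d e (ℰ.E.push f' δ')) :
    ∃ (h' : Q ⟶ P) (δ'' : ℰ.E.val P A), ℰ.Triangle (f ≫ g) h' δ'' ∧ g ≫ h' = f' ≫ d ∧
      ℰ.E.push f δ'' = ℰ.E.pull e δ' := by
  obtain ⟨P₀, h', d₀, e₀, δ'', t₀, hd, -, r₀, -, hδ⟩ := ℰ.et4 s t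
  obtain ⟨b, hbd, hbe⟩ := ℰ.triangle_unique r₀ r
  refine ⟨h' ≫ b.hom, ℰ.E.pull b.inv δ'', ?_, by rw [reassoc_of% hd, hbd], ?_⟩
  · simpa [push_id] using t₀.of_iso (Iso.refl A) b
  · rw [push_pull, hδ, ← pull_comp, ← hbe, b.inv_hom_id_assoc]

/-- (ET4)ᵒᵖ with a prescribed third triangle (the dual of Nakaoka–Palu, Lemma 3.14). -/
theorem et4op_of_triangle {D A B F Q P : C} {f' : D ⟶ A} {f : A ⟶ B} {δ : ℰ.E.val B D}
    {g' : F ⟶ B} {g : B ⟶ Q} {δ' : ℰ.E.val Q F} {d : D ⟶ P} {e : P ⟶ F}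
    (s : ℰ.Triangle f' f δ) (t : ℰ.Triangle g' g δ') (r : ℰ.Triangle d e (ℰ.E.pull g' δ)) :
    ∃ h' : P ⟶ A, ℰ.Conflation h' (f ≫ g) ∧ h' ≫ f = e ≫ g' := by
  obtain ⟨P₀, h', d₀, e₀, δ'', t₀, -, hf, r₀, -, -⟩ := ℰ.et4op s t
  obtain ⟨b, -, hbe⟩ := ℰ.triangle_unique r₀ r
  refine ⟨b.inv ≫ h', ⟨ℰ.E.push b.hom δ'', ?_⟩, ?_⟩
  · simpa [pull_id] using t₀.of_iso b (Iso.refl Q)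
  · rw [Category.assoc, hf, ← hbe, Category.assoc, b.inv_hom_id_assoc]

theorem exists_pullback {A₁ B₁ A₂ B₂ Z : C} {x₁ : A₁ ⟶ B₁} {y₁ : B₁ ⟶ Z} {δ₁ : ℰ.E.val Z A₁}
    {x₂ : A₂ ⟶ B₂} {y₂ : B₂ ⟶ Z} {δ₂ : ℰ.E.val Z A₂} (t₁ : ℰ.Triangle x₁ y₁ δ₁)
    (t₂ : ℰ.Triangle x₂ y₂ δ₂) :
    ∃ (P : C) (i₁ : A₁ ⟶ P) (p₂ : P ⟶ B₂) (i₂ : A₂ ⟶ P) (p₁ : P ⟶ B₁),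
      ℰ.Triangle i₁ p₂ (ℰ.E.pull y₂ δ₁) ∧ ℰ.Triangle i₂ p₁ (ℰ.E.pull y₁ δ₂) := by
  obtain ⟨P, i, p, t⟩ := ℰ.exists_triangle (ℰ.E.pair δ₁ δ₂)
  obtain ⟨p₂, ε₁, s₁, -, hε₁⟩ :=
    et4_of_triangle (ℰ.triangle_zero A₁ A₂) t (by rwa [push_snd_pair])
  obtain ⟨p₁, ε₂, s₂, -, hε₂⟩ :=
    et4_of_triangle (triangle_inr_fst A₁ A₂) t (by rwa [push_fst_pair])
  replace hε₁ := congrArg (ℰ.E.push biprod.fst) hε₁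
  replace hε₂ := congrArg (ℰ.E.push biprod.snd) hε₂
  rw [← push_comp, biprod.inl_fst, push_id, push_pull, push_fst_pair] at hε₁
  rw [← push_comp, biprod.inr_snd, push_id, push_pull, push_snd_pair] at hε₂
  exact ⟨P, _, p₂, _, p₁, hε₁ ▸ s₁, hε₂ ▸ s₂⟩

theorem exists_pushout {A B₁ Z₁ B₂ Z₂ : C} (h₁ : ℰ.IsExtensionOf A B₁ Z₁)
    (h₂ : ℰ.IsExtensionOf A B₂ Z₂) :
    ∃ P : C, ℰ.IsExtensionOf B₁ P Z₂ ∧ ℰ.IsExtensionOf B₂ P Z₁ := by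
  obtain ⟨x₁, y₁, δ₁, t₁⟩ := h₁
  obtain ⟨x₂, y₂, δ₂, t₂⟩ := h₂
  obtain ⟨P, i, p, t⟩ := ℰ.exists_triangle (ℰ.E.copair δ₁ δ₂)
  obtain ⟨i₁, s₁, -⟩ := et4op_of_triangle t (ℰ.triangle_zero Z₁ Z₂) (by rwa [pull_inl_copair])
  obtain ⟨i₂, s₂, -⟩ := et4op_of_triangle t (triangle_inr_fst Z₁ Z₂) (by rwa [pull_inr_copair])
  exact ⟨P, ⟨_, _, s₁⟩, ⟨_, _, s₂⟩⟩

end Triangle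

section HalfExact

/-- `F(X, -)` is exact at the middle term of every conflation, for every `X`. -/
def CovariantHalfExact (ℰ : ExtriangulatedStructure.{w} C) (F : AbBifunctor.{w₁} C) : Prop :=
  ∀ ⦃A B Z : C⦄ ⦃x : A ⟶ B⦄ ⦃y : B ⟶ Z⦄, ℰ.Conflation x y →
    ∀ ⦃X : C⦄ (ξ : F.val X B), F.push y ξ = 0 → ∃ ξ' : F.val X A, F.push x ξ' = ξ

/-- `F(-, Y)` is exact at the middle term of every conflation, for every `Y`. -/
def ContravariantHalfExact (ℰ : ExtriangulatedStructure.{w} C) (F : AbBifunctor.{w₁} C) : Prop :=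
  ∀ ⦃A B Z : C⦄ ⦃x : A ⟶ B⦄ ⦃y : B ⟶ Z⦄, ℰ.Conflation x y →
    ∀ ⦃Y : C⦄ (ξ : F.val B Y), F.pull x ξ = 0 → ∃ ξ' : F.val Z Y, F.pull y ξ' = ξ

variable {A B Z : C} {x : A ⟶ B} {y : B ⟶ Z} {δ : ℰ.E.val Z A} {F : AbBifunctor.{w₁} C}
  [F.IsAdditive]

theorem CovariantHalfExact.exists_push_eq_of_tensor_eq_zero (hF : ℰ.CovariantHalfExact F)
    (t : ℰ.Triangle x y δ) {X : C} {z : F.val X Z} (h : δ ⊙ z = 0) :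
    ∃ b : F.val X B, F.push y b = z := by
  obtain ⟨M, N, p, q, x', y', hp, hq, hpq⟩ := AbBifunctor.exists_push_eq_of_tensor_eq_zero h
  obtain ⟨B', i, f, s⟩ := ℰ.exists_triangle (ℰ.E.copair δ x')
  obtain ⟨l, hl⟩ := s.exists_lift (p ≫ biprod.inl - q ≫ biprod.inr) (by
    rw [pull_sub, pull_comp, pull_comp, pull_inl_copair, pull_inr_copair, hpq, sub_self])
  obtain ⟨g, hg, hgf⟩ := et4op_of_triangle s (ℰ.triangle_zero Z M) (by rwa [pull_inl_copair])
  have hlf : F.push f (F.push l y') = F.push biprod.inl z := by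
    rw [← push_comp, hl, push_sub, push_comp, push_comp, hp, hq, map_zero, sub_zero]
  obtain ⟨b, hb⟩ := hF hg (F.push l y') (by
    rw [push_comp, hlf, ← push_comp, biprod.inl_snd, push_zero])
  refine ⟨b, ?_⟩
  calc F.push y b = F.push (g ≫ f ≫ biprod.fst) b := by rw [reassoc_of% hgf]; simp
    _ = F.push biprod.fst (F.push biprod.inl z) := by rw [push_comp, push_comp, hb, hlf]
    _ = z := by rw [← push_comp, biprod.inl_fst, push_id]

theorem CovariantHalfExact.exists_eq_tensor_of_push_eq_zero (hF : ℰ.CovariantHalfExact F)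
    (t : ℰ.Triangle x y δ) {X : C} {ξ : (diamond ℰ.E F).val X A}
    (h : (diamond ℰ.E F).push x ξ = 0) : ∃ z : F.val X Z, ξ = δ ⊙ z := by
  obtain ⟨M, x₀, y₀, rfl⟩ := exists_eq_tensor ξ
  rw [push_tensor] at h
  obtain ⟨M', N, p, q, x', y', rfl, hq, hpq⟩ := AbBifunctor.exists_push_eq_of_tensor_eq_zero h
  rw [← push_pull] at hpq
  obtain ⟨D, g, g', s⟩ := ℰ.exists_triangle x'
  obtain ⟨P, -, d, e, δ', -, -, -, r, hd, he⟩ := ℰ.et4 t s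
  obtain ⟨l, hl⟩ := r.exists_lift q (by
    rw [← push_pull, hpq, ← push_comp, t.comp_zero, push_zero])
  obtain ⟨k, hk⟩ := t.exists_pull_eq (ℰ.E.pull l δ' - ℰ.E.pull p x₀) (by
    rw [map_sub, push_pull, he, ← pull_comp, hl, hpq, sub_self])
  have hx₀ : ℰ.E.pull p x₀ = ℰ.E.pull (l - k ≫ d) δ' := by
    rw [pull_sub, pull_comp, hd, hk, sub_sub_cancel]
  obtain ⟨z, hz⟩ := hF ⟨_, r⟩ (F.push (l - k ≫ d) y') (by
    rw [← push_comp, Preadditive.sub_comp, Category.assoc, r.comp_zero, comp_zero, sub_zero, hl,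
      hq])
  refine ⟨z, ?_⟩
  rw [← pull_tensor_eq_tensor_push, hx₀, pull_tensor_eq_tensor_push, ← hz,
    ← pull_tensor_eq_tensor_push, hd]

theorem CovariantHalfExact.diamond (hF : ℰ.CovariantHalfExact F) :
    ℰ.CovariantHalfExact (diamond ℰ.E F) := by
  rintro A B Z x y ⟨δ, t⟩ X ξ h
  obtain ⟨M, x₀, y₀, rfl⟩ := exists_eq_tensor ξ
  rw [push_tensor] at h
  obtain ⟨D, g, g', s⟩ := ℰ.exists_triangle x₀
  obtain ⟨P, -, d, e, δ', -, -, -, r, -, he⟩ := ℰ.et4 t s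
  obtain ⟨b, rfl⟩ := hF.exists_push_eq_of_tensor_eq_zero r h
  exact ⟨δ' ⊙ b, by rw [push_tensor, he, pull_tensor_eq_tensor_push]⟩

theorem ContravariantHalfExact.exists_pull_eq_of_tensor_eq_zero
    (hF : ℰ.ContravariantHalfExact F) (t : ℰ.Triangle x y δ) {Y : C} {a : F.val A Y}
    (h : a ⊙ δ = 0) : ∃ b : F.val B Y, F.pull x b = a := by
  obtain ⟨M, N, m, f, x', s, hm, hf, hs⟩ := AbBifunctor.exists_pull_eq_of_tensor_eq_zero h
  obtain ⟨B', i, p, r⟩ := ℰ.exists_triangle (ℰ.E.pair δ s)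
  obtain ⟨l, hl⟩ := r.exists_desc (biprod.fst ≫ m - biprod.snd ≫ f) (by
    rw [push_sub, push_comp, push_comp, push_fst_pair, push_snd_pair, hs, sub_self])
  obtain ⟨g, _, hg, hig, -⟩ := et4_of_triangle (triangle_inr_fst A N) r (by rwa [push_fst_pair])
  have hil : F.pull i (F.pull l x') = F.pull biprod.fst a := by
    rw [← pull_comp, hl, pull_sub, pull_comp, pull_comp, hm, hf, map_zero, sub_zero]
  obtain ⟨b, hb⟩ := hF ⟨_, hg⟩ (F.pull l x') (by
    rw [pull_comp, hil, ← pull_comp, biprod.inr_fst, pull_zero])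
  refine ⟨b, ?_⟩
  calc F.pull x b = F.pull (biprod.inl ≫ i ≫ g) b := by rw [hig]; simp
    _ = F.pull biprod.inl (F.pull biprod.fst a) := by rw [pull_comp, pull_comp, hb, hil]
    _ = a := by rw [← pull_comp, biprod.inl_fst, pull_id]

theorem ContravariantHalfExact.diamond (hF : ℰ.ContravariantHalfExact F) :
    ℰ.ContravariantHalfExact (diamond F ℰ.E) := by
  rintro A B Z x y ⟨δ, t⟩ Y ξ h
  obtain ⟨M, x₀, y₀, rfl⟩ := exists_eq_tensor ξ
  rw [pull_tensor] at h
  obtain ⟨D, g, g', s⟩ := ℰ.exists_triangle y₀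
  obtain ⟨P, -, d, e, δ', -, -, -, r, -, hd⟩ := ℰ.et4op s t
  obtain ⟨b, rfl⟩ := hF.exists_pull_eq_of_tensor_eq_zero r h
  exact ⟨b ⊙ δ', by rw [pull_tensor, ← hd, pull_tensor_eq_tensor_push]⟩

theorem ContravariantHalfExact.of_iso {F G : AbBifunctor.{w₁} C}
    (hF : ℰ.ContravariantHalfExact F) (e : F ≅ G) : ℰ.ContravariantHalfExact G := by
  intro A B Z x y hxy Y ξ h
  obtain ⟨ξ', hξ'⟩ := hF hxy (appHom e.inv B Y ξ) (by rw [← appHom_pull, h, map_zero])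
  exact ⟨appHom e.hom Z Y ξ', by rw [← appHom_pull, hξ', appHom_hom_appHom_inv]⟩

end HalfExact

section ExtFunctor

instance isAdditive_extFunctor (n : ℕ) : (ℰ.extFunctor (n + 1)).IsAdditive := by
  induction n with
  | zero => exact inferInstanceAs (lift ℰ.E).IsAdditive
  | succ n _ => exact inferInstanceAs (diamond ℰ.E (ℰ.extFunctor (n + 1))).IsAdditive

/-- `𝔼ⁿ⁺²` is defined as `𝔼 ⋄ 𝔼ⁿ⁺¹`; it is also `𝔼ⁿ⁺¹ ⋄ 𝔼`, which makes the contravariant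
variable accessible. -/
noncomputable def extFunctorSuccIso (ℰ : ExtriangulatedStructure.{w} C) :
    ∀ n : ℕ, ℰ.extFunctor (n + 2) ≅ diamond (ℰ.extFunctor (n + 1)) ℰ.E
  | 0 => diamondLiftIso ℰ.E ℰ.E
  | n + 1 => diamondIsoRight ℰ.E (extFunctorSuccIso ℰ n) ≪≫
      diamondAssoc ℰ.E (ℰ.extFunctor (n + 1)) ℰ.E

theorem covariantHalfExact_extFunctor (n : ℕ) :
    ℰ.CovariantHalfExact (ℰ.extFunctor (n + 1)) := by
  induction n with
  | zero =>
    rintro A B Z x y ⟨δ, t⟩ X ξ h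
    obtain ⟨ε, hε⟩ := t.exists_push_inflation_eq ξ.down (congrArg ULift.down h)
    exact ⟨⟨ε⟩, ULift.ext _ _ hε⟩
  | succ n ih => exact ih.diamond

theorem contravariantHalfExact_extFunctor (n : ℕ) :
    ℰ.ContravariantHalfExact (ℰ.extFunctor (n + 1)) := by
  induction n with
  | zero =>
    rintro A B Z x y ⟨δ, t⟩ Y ξ h
    obtain ⟨ε, hε⟩ := t.exists_pull_deflation_eq ξ.down (congrArg ULift.down h)
    exact ⟨⟨ε⟩, ULift.ext _ _ hε⟩
  | succ n ih => exact ih.diamond.of_iso (ℰ.extFunctorSuccIso n).symm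

theorem extZero_iff {k : ℕ} {X A : C} :
    ℰ.ExtZero k X A ↔ ∀ ξ : (ℰ.extFunctor k).val X A, ξ = 0 :=
  ⟨fun h ξ => h.elim ξ 0, fun h => ⟨fun ξ ξ' => (h ξ).trans (h ξ').symm⟩⟩

theorem ExtZero.eq_zero {X A : C} (h : ℰ.ExtZero 1 X A) (δ : ℰ.E.val X A) : δ = 0 :=
  congrArg ULift.down (extZero_iff.1 h ⟨δ⟩)

namespace IsExtensionOf

variable {A B Z : C}

theorem extZero_covariant_middle (h : ℰ.IsExtensionOf A B Z) {n : ℕ} {X : C}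
    (hA : ℰ.ExtZero (n + 1) X A) (hZ : ℰ.ExtZero (n + 1) X Z) : ℰ.ExtZero (n + 1) X B := by
  obtain ⟨x, y, hxy⟩ := h
  refine extZero_iff.2 fun ξ => ?_
  obtain ⟨ξ', rfl⟩ := covariantHalfExact_extFunctor n hxy ξ (extZero_iff.1 hZ _)
  rw [extZero_iff.1 hA ξ', map_zero]

theorem extZero_covariant_left (h : ℰ.IsExtensionOf A B Z) {n : ℕ} {X : C}
    (hZ : ℰ.ExtZero (n + 1) X Z) (hB : ℰ.ExtZero (n + 2) X B) : ℰ.ExtZero (n + 2) X A := by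
  obtain ⟨x, y, δ, t⟩ := h
  refine extZero_iff.2 fun ξ => ?_
  obtain ⟨z, rfl⟩ := (covariantHalfExact_extFunctor n).exists_eq_tensor_of_push_eq_zero t
    (ξ := ξ) (extZero_iff.1 hB _)
  exact (congrArg (δ ⊙ ·) (extZero_iff.1 hZ z)).trans (tensor_zero δ)

theorem extZero_covariant_right (h : ℰ.IsExtensionOf A B Z) {n : ℕ} {X : C}
    (hB : ℰ.ExtZero (n + 1) X B) (hA : ℰ.ExtZero (n + 2) X A) : ℰ.ExtZero (n + 1) X Z := by
  obtain ⟨x, y, δ, t⟩ := h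
  refine extZero_iff.2 fun z => ?_
  obtain ⟨b, rfl⟩ := (covariantHalfExact_extFunctor n).exists_push_eq_of_tensor_eq_zero t
    (z := z) (extZero_iff.1 hA _)
  rw [extZero_iff.1 hB b, map_zero]

theorem extZero_contravariant_middle (h : ℰ.IsExtensionOf A B Z) {n : ℕ} {Y : C}
    (hA : ℰ.ExtZero (n + 1) A Y) (hZ : ℰ.ExtZero (n + 1) Z Y) : ℰ.ExtZero (n + 1) B Y := by
  obtain ⟨x, y, hxy⟩ := h
  refine extZero_iff.2 fun ξ => ?_
  obtain ⟨ξ', rfl⟩ := contravariantHalfExact_extFunctor n hxy ξ (extZero_iff.1 hA _)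
  rw [extZero_iff.1 hZ ξ', map_zero]

theorem extZero_contravariant_left (h : ℰ.IsExtensionOf A B Z) {n : ℕ} {Y : C}
    (hB : ℰ.ExtZero (n + 1) B Y) (hZ : ℰ.ExtZero (n + 2) Z Y) : ℰ.ExtZero (n + 1) A Y := by
  obtain ⟨x, y, δ, t⟩ := h
  refine extZero_iff.2 fun a => ?_
  have ha : a ⊙ δ = 0 := by
    rw [← appHom_hom_appHom_inv (ℰ.extFunctorSuccIso n) (a ⊙ δ), extZero_iff.1 hZ (appHom _ _ _ _),
      map_zero]
  obtain ⟨b, rfl⟩ := (contravariantHalfExact_extFunctor n).exists_pull_eq_of_tensor_eq_zero t ha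
  rw [extZero_iff.1 hB b, map_zero]

end IsExtensionOf

end ExtFunctor

end ExtriangulatedStructure

/-! ### Orthogonal classes and approximations -/

section Classes

variable {C : Type u} [Category.{v} C] [Preadditive C] [HasZeroObject C] [HasBinaryBiproducts C]
  {ℳ 𝒩 : ObjectProperty C}

open scoped ZeroObject

theorem smd_mono (h : ℳ ≤ 𝒩) : smd ℳ ≤ smd 𝒩 :=
  fun _ ⟨M, A', hM, e⟩ => ⟨M, A', h M hM, e⟩

theorem le_smd : ℳ ≤ smd ℳ :=
  fun M hM => ⟨M, 0, hM, ⟨(isoBiprodZero (isZero_zero C)).symm⟩⟩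

theorem smd_zero {M : C} (hM : ℳ M) : smd ℳ (0 : C) :=
  ⟨M, M, hM, ⟨(isoZeroBiprod (isZero_zero C)).symm⟩⟩

theorem smd_inf_eq {ℳ 𝒩 : ObjectProperty C} (hℳ : ℳ = smd ℳ) (h𝒩 : 𝒩 = smd 𝒩) :
    smd (ℳ ⊓ 𝒩) = ℳ ⊓ 𝒩 :=
  le_antisymm (le_inf ((smd_mono inf_le_left).trans hℳ.ge) ((smd_mono inf_le_right).trans h𝒩.ge))
    le_smd

end Classes

namespace ExtriangulatedStructure

variable {C : Type u} [Category.{v} C] [Preadditive C] [HasZeroObject C] [HasBinaryBiproducts C]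
  {ℰ : ExtriangulatedStructure.{w} C} {𝒜 ℬ 𝒳 𝒴 𝒯 ω α : ObjectProperty C}

open AbBifunctor
open scoped ZeroObject

section Orthogonality

theorem rightPerp_iff {A : C} :
    ℰ.rightPerp 𝒳 A ↔ ∀ (n : ℕ) (X : C), 𝒳 X → ℰ.ExtZero (n + 1) X A :=
  ⟨fun h n => h (n + 1) n.succ_pos, fun h => fun | n + 1, _ => h n⟩

theorem leftPerp_iff {A : C} :
    ℰ.leftPerp 𝒳 A ↔ ∀ (n : ℕ) (X : C), 𝒳 X → ℰ.ExtZero (n + 1) A X :=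
  ⟨fun h n => h (n + 1) n.succ_pos, fun h => fun | n + 1, _ => h n⟩

theorem le_leftPerp_rightPerp : 𝒯 ≤ ℰ.leftPerp (ℰ.rightPerp 𝒯) :=
  fun T hT i hi _ hY => hY i hi T hT

theorem leftPerp_anti (h : 𝒜 ≤ ℬ) : ℰ.leftPerp ℬ ≤ ℰ.leftPerp 𝒜 :=
  fun _ hM i hi X hX => hM i hi X (h X hX)

theorem closedUnderExtensions_rightPerp : ℰ.ClosedUnderExtensions (ℰ.rightPerp 𝒜) := by
  intro A B Z h hA hZ
  rw [rightPerp_iff] at hA hZ ⊢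
  exact fun n X hX => h.extZero_covariant_middle (hA n X hX) (hZ n X hX)

theorem closedUnderExtensions_leftPerp : ℰ.ClosedUnderExtensions (ℰ.leftPerp 𝒜) := by
  intro A B Z h hA hZ
  rw [leftPerp_iff] at hA hZ ⊢
  exact fun n X hX => h.extZero_contravariant_middle (hA n X hX) (hZ n X hX)

theorem IsExtensionOf.leftPerp_left {A B Z : C} (h : ℰ.IsExtensionOf A B Z)
    (hB : ℰ.leftPerp 𝒜 B) (hZ : ℰ.leftPerp 𝒜 Z) : ℰ.leftPerp 𝒜 A := by
  rw [leftPerp_iff] at hB hZ ⊢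
  exact fun n X hX => h.extZero_contravariant_left (hB n X hX) (hZ (n + 1) X hX)

theorem ExtZero.of_retract {n : ℕ} {X X' Y : C} (h : ℰ.ExtZero (n + 1) X' Y) (r : Retract X X') :
    ℰ.ExtZero (n + 1) X Y := by
  refine extZero_iff.2 fun ξ => ?_
  rw [← pull_id _ ξ, ← r.retract, pull_comp, extZero_iff.1 h (pull _ _ ξ), map_zero]

theorem smd_leftPerp_le : smd (ℰ.leftPerp 𝒜) ≤ ℰ.leftPerp 𝒜 := by
  rintro A ⟨M, A', hM, ⟨e⟩⟩
  rw [leftPerp_iff] at hM ⊢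
  exact fun n X hX => (hM n X hX).of_retract ⟨biprod.inl ≫ e.hom, e.inv ≫ biprod.fst, by simp⟩

theorem coresolved_le_leftPerp (h : 𝒴 ≤ ℰ.leftPerp 𝒜) :
    ℰ.coresolved 𝒴 𝒳 ≤ ℰ.leftPerp 𝒜 := by
  rintro M ⟨n, hM⟩
  induction n generalizing M with
  | zero =>
    obtain ⟨Y, hY, ⟨e⟩⟩ := hM
    exact leftPerp_iff.2 fun n X hX => (leftPerp_iff.1 (h Y hY.2) n X hX).of_retract e.retract
  | succ n ih =>
    obtain ⟨Y, N, hY, -, hMYN, hN⟩ := hM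
    exact hMYN.leftPerp_left (h Y hY) (ih N hN)

theorem coresolved_smd_le_leftPerp :
    ℰ.coresolved (smd 𝒯) 𝒳 ≤ ℰ.leftPerp (ℰ.rightPerp 𝒯) :=
  coresolved_le_leftPerp ((smd_mono le_leftPerp_rightPerp).trans smd_leftPerp_le)

theorem HasFiniteCoresolution.mono (h : 𝒜 ≤ ℬ) {n : ℕ} {M : C}
    (hM : ℰ.HasFiniteCoresolution 𝒜 𝒳 n M) : ℰ.HasFiniteCoresolution ℬ 𝒳 n M := by
  induction n generalizing M with
  | zero => exact ObjectProperty.monotone_isoClosure (inf_le_inf_left 𝒳 h) M hM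
  | succ n ih =>
    obtain ⟨Y, N, hY, hN, hMYN, hNres⟩ := hM
    exact ⟨Y, N, h Y hY, hN, hMYN, ih hNres⟩

theorem coresolved_mono (h : 𝒜 ≤ ℬ) : ℰ.coresolved 𝒜 𝒳 ≤ ℰ.coresolved ℬ 𝒳 :=
  fun _ ⟨n, hM⟩ => ⟨n, hM.mono h⟩

theorem coresolved_of_isExtensionOf {M Y N : C} (h : ℰ.IsExtensionOf M Y N) (hY : 𝒴 Y)
    (hN : (ℰ.coresolved 𝒴 𝒳 ⊓ 𝒳) N) : ℰ.coresolved 𝒴 𝒳 M :=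
  hN.1.elim fun n hn => ⟨n + 1, Y, N, hY, hN.2, h, hn⟩

theorem extZero_of_projDim_le {n : ℕ} (h : ℰ.projDim 𝒳 𝒯 ≤ n) {T X : C} (hT : 𝒯 T) (hX : 𝒳 X)
    {k : ℕ} (hk : n < k) : ℰ.ExtZero k T X := by
  have hTn : ℰ.projDimObj 𝒳 T < k :=
    (sSup_le_iff.1 h _ ⟨T, hT, rfl⟩).trans_lt (Nat.cast_lt.2 hk)
  obtain ⟨_, ⟨m, rfl, hm⟩, hmk⟩ := sInf_lt_iff.1 hTn
  exact hm k (Nat.cast_lt.1 hmk) X hX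

theorem injDimObj_le_of_projDim_le {n : ℕ} (h : ℰ.projDim 𝒳 𝒯 ≤ n) {X : C} (hX : 𝒳 X) :
    ℰ.injDimObj 𝒯 X ≤ n :=
  sInf_le ⟨n, rfl, fun _ hk _ hT => extZero_of_projDim_le h hT hX hk⟩

theorem isHereditary_leftPerp : ℰ.IsHereditary (ℰ.leftPerp ℬ) ℬ := by
  refine nonpos_iff_eq_zero.1 (sSup_le ?_)
  rintro _ ⟨B, ⟨hB, -⟩, rfl⟩
  exact sInf_le ⟨0, rfl, fun k hk A hA => hA.1 k hk B hB⟩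

end Orthogonality

section Precover

theorem exists_lift_of_coresolved {T Z W : C} {f : T ⟶ Z} (hf : IsPrecover 𝒯 f)
    (hZ : ℰ.rightPerp 𝒯 Z) (hW : ℰ.coresolved 𝒯 𝒳 W) (g : W ⟶ Z) : ∃ l : W ⟶ T, l ≫ f = g := by
  obtain ⟨_ | n, hn⟩ := hW
  · obtain ⟨Y, hY, ⟨e⟩⟩ := hn
    obtain ⟨l, hl : l ≫ f = e.inv ≫ g⟩ := hf.2 Y hY.2 (e.inv ≫ g)
    exact ⟨e.hom ≫ l, by rw [Category.assoc, hl, e.hom_inv_id_assoc]⟩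
  · obtain ⟨Y, N, hY, -, ⟨x, y, ε, t⟩, hN⟩ := hn
    have hNZ : ℰ.ExtZero 1 N Z :=
      coresolved_le_leftPerp le_leftPerp_rightPerp N ⟨n, hN⟩ 1 le_rfl Z hZ
    obtain ⟨g', rfl⟩ := t.exists_desc g (hNZ.eq_zero _)
    obtain ⟨l, rfl⟩ := hf.2 Y hY g'
    exact ⟨x ≫ l, Category.assoc _ _ _⟩

theorem rightPerp_of_isPrecover {K T Z : C} {i : K ⟶ T} {f : T ⟶ Z} (hf : IsPrecover 𝒯 f)
    (hif : ℰ.Conflation i f) (hT : ℰ.rightPerp 𝒯 T) (hZ : ℰ.rightPerp 𝒯 Z) :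
    ℰ.rightPerp 𝒯 K := by
  obtain ⟨κ, t⟩ := id hif
  rw [rightPerp_iff] at hT hZ ⊢
  rintro (_ | n) T' hT'
  · refine extZero_iff.2 fun ⟨ε⟩ => ULift.ext _ _ ?_
    obtain ⟨c, rfl⟩ := t.exists_pull_eq ε ((hT 0 T' hT').eq_zero _)
    obtain ⟨c', rfl⟩ := hf.2 T' hT' c
    exact (pull_comp _ _ _ _).trans ((congrArg _ t.pull_eq_zero).trans (map_zero _))
  · exact IsExtensionOf.extZero_covariant_left ⟨i, f, hif⟩ (hZ n T' hT') (hT (n + 1) T' hT')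

/-- The pullback of the two conflations is an extension of `T` by `X'`; it is also `K ⊞ W`,
since the lift of `W ⟶ Z` splits it. -/
theorem smd_kernel_of_lift (hext : ℰ.ClosedUnderExtensions 𝒳) {X' W Z K T : C} {a : X' ⟶ W}
    {l : W ⟶ T} {i : K ⟶ T} {f : T ⟶ Z} (haf : ℰ.Conflation a (l ≫ f)) (hif : ℰ.Conflation i f)
    (hX' : 𝒳 X') (hT : 𝒳 T) : smd 𝒳 K := by
  obtain ⟨δ, t⟩ := haf
  obtain ⟨κ, s⟩ := hif
  obtain ⟨P, i₁, p₂, i₂, p₁, t₁, t₂⟩ := exists_pullback t s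
  rw [pull_comp, s.pull_eq_zero, map_zero] at t₂
  obtain ⟨e, -⟩ := ℰ.triangle_unique (ℰ.triangle_zero K W) t₂
  exact ⟨P, W, hext ⟨_, _, _, t₁⟩ hX' hT, ⟨e⟩⟩

theorem isRelativeGenerator_rightPerp (hW : ℰ.DeflationCancellation) (hsmd : 𝒳 = smd 𝒳)
    (hext : ℰ.ClosedUnderExtensions 𝒳) (h2 : ℰ.T2 𝒳 𝒯) (h3 : ℰ.T3 𝒳 𝒯) (h5 : ℰ.T5 𝒳 𝒯) :
    ℰ.IsRelativeGenerator (𝒯 ⊓ 𝒳) (ℰ.rightPerp 𝒯 ⊓ 𝒳) := by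
  refine ⟨le_inf h2 inf_le_right, fun Z ⟨hZ, hZX⟩ => ?_⟩
  obtain ⟨T, f, hTX, hf⟩ := h5 Z ⟨hZX, hZ⟩
  obtain ⟨ω, hω, -, hgen⟩ := h3
  obtain ⟨X', W, hX', hWω, a, g, hag⟩ := hgen Z hZX
  obtain ⟨l, rfl⟩ := exists_lift_of_coresolved hf hZ (hω W hWω) g
  obtain ⟨K, i, hif⟩ := hW l f ⟨X', a, hag⟩
  have hK : ℰ.rightPerp 𝒯 K := rightPerp_of_isPrecover hf hif (h2 T ⟨hf.1, hTX⟩) hZ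
  have hKX : smd 𝒳 K := smd_kernel_of_lift hext hag hif hX' hTX
  exact ⟨K, T, ⟨hK, hsmd.ge K hKX⟩, ⟨hf.1, hTX⟩, i, f, hif⟩

end Precover

section Fac

theorem IsRelativeGenerator.le_fac (h : ℰ.IsRelativeGenerator (𝒯 ⊓ 𝒳) 𝒴) (h𝒴 : 𝒴 ≤ 𝒳) (k : ℕ) :
    𝒴 ≤ ℰ.Fac 𝒳 𝒯 k := by
  induction k with
  | zero => exact le_top
  | succ k ih =>
    intro Z hZ
    obtain ⟨K, T, hK, hT, hKTZ⟩ := h.2 Z hZ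
    exact ⟨K, T, h𝒴 K hK, hT, hKTZ, ih K hK⟩

/-- Dimension shifting: `𝔼ⁿ⁺¹(T, Z) = 0` follows from `𝔼ⁿ⁺¹⁺ᵏ(T, 𝒳) = 0`. -/
theorem extZero_of_fac {T : C} (hT : ∀ Y : C, (𝒯 ⊓ 𝒳) Y → ∀ n : ℕ, ℰ.ExtZero (n + 1) T Y)
    {k n : ℕ} (hn : ∀ X : C, 𝒳 X → ℰ.ExtZero (n + k + 1) T X) {Z : C} (hZ : (ℰ.Fac 𝒳 𝒯 k ⊓ 𝒳) Z) :
    ℰ.ExtZero (n + 1) T Z := by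
  induction k generalizing Z n with
  | zero => exact hn Z hZ.2
  | succ k ih =>
    obtain ⟨⟨K, Y, hKX, hY, hKYZ, hK⟩, -⟩ := hZ
    refine hKYZ.extZero_covariant_right (hT Y hY n) (ih (n := n + 1) (fun X hX => ?_) ⟨hK, hKX⟩)
    simpa only [add_right_comm, add_assoc] using hn X hX

theorem rightPerp_inf_eq_fac_inf (h2 : ℰ.T2 𝒳 𝒯)
    (hgen : ℰ.IsRelativeGenerator (𝒯 ⊓ 𝒳) (ℰ.rightPerp 𝒯 ⊓ 𝒳)) {k : ℕ}
    (hk : ℰ.projDim 𝒳 𝒯 ≤ k) : ℰ.rightPerp 𝒯 ⊓ 𝒳 = ℰ.Fac 𝒳 𝒯 k ⊓ 𝒳 := by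
  refine le_antisymm (le_inf (hgen.le_fac inf_le_right k) inf_le_right) (fun Z hZ => ⟨?_, hZ.2⟩)
  refine rightPerp_iff.2 fun n T hT => extZero_of_fac (fun Y hY m => ?_) (fun X hX => ?_) hZ
  · exact rightPerp_iff.1 (h2 Y hY) m T hT
  · exact extZero_of_projDim_le hk hT hX (by omega)

end Fac

section Approximation

theorem exists_rightApproximation_of_isExtensionOf (hext : ℰ.ClosedUnderExtensions 𝒳)
    (hℬ : ℰ.ClosedUnderExtensions ℬ) (hgen : ℰ.IsRelativeGenerator ω (ℬ ⊓ 𝒳)) (hω𝒴 : ω ≤ 𝒴)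
    {X W X₁ B₁ A₁ : C} (hXW : ℰ.IsExtensionOf X W X₁) (hXB : ℰ.IsExtensionOf X₁ B₁ A₁)
    (hX : 𝒳 X) (hW : ℬ W) (hX₁ : 𝒳 X₁) (hB₁ : (ℬ ⊓ 𝒳) B₁) (hA₁ : (ℰ.coresolved 𝒴 𝒳 ⊓ 𝒳) A₁) :
    ∃ B A : C, (ℬ ⊓ 𝒳) B ∧ (ℰ.coresolved 𝒴 𝒳 ⊓ 𝒳) A ∧ ℰ.IsExtensionOf X B A := by
  obtain ⟨K, T, ⟨hK, hKX⟩, hT, i, p, κ, tT⟩ := hgen.2 B₁ hB₁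
  obtain ⟨x₁, y₁, δ₁, tB⟩ := hXB
  obtain ⟨A, h, d, e, δA, tA, -, -, tK, -⟩ := ℰ.et4op tT tB
  obtain ⟨x, w, δ, tW⟩ := hXW
  obtain ⟨B, i₁, p₂, i₂, p₁, tXBA, tKBW⟩ := exists_pullback tW tK
  have hA : 𝒳 A := hext ⟨d, e, _, tK⟩ hKX hX₁
  refine ⟨B, A, ⟨hℬ ⟨_, _, _, tKBW⟩ hK hW, hext ⟨_, _, _, tXBA⟩ hX hA⟩, ⟨?_, hA⟩, _, _, _, tXBA⟩
  exact coresolved_of_isExtensionOf ⟨_, _, _, tA⟩ (hω𝒴 T hT) hA₁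

theorem exists_rightApproximation (hsmd : 𝒳 = smd 𝒳) (hext : ℰ.ClosedUnderExtensions 𝒳)
    (hgen : ℰ.IsRelativeGenerator ω (ℰ.rightPerp 𝒯 ⊓ 𝒳)) (hα : α ≤ ℰ.rightPerp 𝒯)
    (hcog : ℰ.IsRelativeCogenerator α 𝒳) (n : ℕ) {X : C} (hX : 𝒳 X)
    (hn : ∀ k : ℕ, n < k → ∀ T : C, 𝒯 T → ℰ.ExtZero k T X) :
    ∃ B A : C, (ℰ.rightPerp 𝒯 ⊓ 𝒳) B ∧ (ℰ.coresolved (smd ω) 𝒳 ⊓ 𝒳) A ∧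
      ℰ.IsExtensionOf X B A := by
  induction n generalizing X with
  | zero =>
    have hXperp : ℰ.rightPerp 𝒯 X := hn
    obtain ⟨-, T, -, hT, -⟩ := hgen.2 X ⟨hXperp, hX⟩
    have h0 : 𝒳 (0 : C) := hsmd.ge _ (smd_zero hX)
    exact ⟨X, 0, ⟨hXperp, hX⟩, ⟨⟨0, 0, ⟨h0, smd_zero hT⟩, ⟨Iso.refl _⟩⟩, h0⟩,
      _, _, _, triangle_id_zero X⟩
  | succ n ih =>
    obtain ⟨W, X₁, hWα, hX₁, h⟩ := hcog.2 X hX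
    obtain ⟨B₁, A₁, hB₁, hA₁, h₁⟩ := ih hX₁ fun k hk T hT => by
      obtain ⟨k, rfl⟩ := Nat.exists_eq_add_of_le' (Nat.one_le_of_lt hk)
      exact h.extZero_covariant_right (rightPerp_iff.1 (hα W hWα) k T hT) (hn _ (by omega) T hT)
    exact exists_rightApproximation_of_isExtensionOf hext closedUnderExtensions_rightPerp hgen
      le_smd h h₁ hX (hα W hWα) hX₁ hB₁ hA₁

theorem isRightComplete_coresolved (hsmd : 𝒳 = smd 𝒳) (hext : ℰ.ClosedUnderExtensions 𝒳)
    (hid : ∀ X : C, 𝒳 X → ℰ.injDimObj 𝒯 X < ⊤)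
    (hgen : ℰ.IsRelativeGenerator ω (ℰ.rightPerp 𝒯 ⊓ 𝒳)) (hα : α ≤ ℰ.rightPerp 𝒯)
    (hcog : ℰ.IsRelativeCogenerator α 𝒳) :
    ℰ.IsRightComplete 𝒳 (ℰ.coresolved (smd ω) 𝒳) (ℰ.rightPerp 𝒯) := by
  intro X hX
  obtain ⟨_, ⟨n, -, hn⟩, -⟩ := sInf_lt_iff.1 (hid X hX)
  exact exists_rightApproximation hsmd hext hgen hα hcog n hX hn

theorem IsRightComplete.mono (h : ℰ.IsRightComplete 𝒳 𝒜 ℬ) {𝒜' : ObjectProperty C}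
    (h𝒜 : 𝒜 ≤ 𝒜') : ℰ.IsRightComplete 𝒳 𝒜' ℬ := by
  intro X hX
  obtain ⟨B, A, hB, hA, hXBA⟩ := h X hX
  exact ⟨B, A, hB, inf_le_inf_right 𝒳 h𝒜 A hA, hXBA⟩

theorem IsRightComplete.isLeftComplete (h : ℰ.IsRightComplete 𝒳 𝒜 ℬ)
    (hext : ℰ.ClosedUnderExtensions 𝒳) (h𝒜 : ℰ.ClosedUnderExtensions 𝒜)
    (hω : ω ≤ 𝒜) (hgen : ℰ.IsRelativeGenerator ω 𝒳) : ℰ.IsLeftComplete 𝒳 𝒜 ℬ := by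
  intro X hX
  obtain ⟨X', W, hX', hW, hXWX'⟩ := hgen.2 X hX
  obtain ⟨B, A, hB, hA, hXBA⟩ := h X' hX'
  obtain ⟨P, hWPA, hBPX⟩ := exists_pushout hXWX' hXBA
  exact ⟨B, P, hB, ⟨h𝒜 hWPA (hω W hW) hA.1, hext hWPA (hgen.1 W hW) hA.2⟩, hBPX⟩

theorem IsRelativeGenerator.leftPerp_inf_le_smd (h : ℰ.IsRelativeGenerator ω 𝒴) :
    ℰ.leftPerp 𝒴 ⊓ 𝒴 ≤ smd ω := by
  rintro B ⟨hB, hB𝒴⟩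
  obtain ⟨K, T, hK, hT, i, p, κ, t⟩ := h.2 B hB𝒴
  rw [(hB 1 le_rfl K hK).eq_zero κ] at t
  obtain ⟨e, -⟩ := ℰ.triangle_unique (triangle_inr_fst B K) t
  exact ⟨T, K, hT, ⟨e⟩⟩

theorem IsRightComplete.leftPerp_inf_le_coresolved
    (h : ℰ.IsRightComplete 𝒳 (ℰ.coresolved (smd ω) 𝒳) ℬ)
    (hgen : ℰ.IsRelativeGenerator ω (ℬ ⊓ 𝒳)) (hω : ω ≤ ℰ.leftPerp (ℬ ⊓ 𝒳)) :
    ℰ.leftPerp (ℬ ⊓ 𝒳) ⊓ 𝒳 ≤ ℰ.coresolved (smd ω) 𝒳 := by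
  rintro M ⟨hM, hMX⟩
  obtain ⟨B, A, hB, hA, hMBA⟩ := h M hMX
  have hAperp : ℰ.leftPerp (ℬ ⊓ 𝒳) A :=
    coresolved_le_leftPerp ((smd_mono hω).trans smd_leftPerp_le) A hA.1
  have hBω : smd ω B :=
    hgen.leftPerp_inf_le_smd B ⟨closedUnderExtensions_leftPerp hMBA hM hAperp, hB⟩
  exact coresolved_of_isExtensionOf hMBA hBω hA

theorem leftPerp_rightPerp_inf_eq_coresolved_inf
    (hgen : ℰ.IsRelativeGenerator (𝒯 ⊓ 𝒳) (ℰ.rightPerp 𝒯 ⊓ 𝒳))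
    (hright : ℰ.IsRightComplete 𝒳 (ℰ.coresolved (smd (𝒯 ⊓ 𝒳)) 𝒳) (ℰ.rightPerp 𝒯)) :
    ℰ.leftPerp (ℰ.rightPerp 𝒯 ⊓ 𝒳) ⊓ 𝒳 = ℰ.leftPerp (ℰ.rightPerp 𝒯) ⊓ 𝒳 ∧
      ℰ.leftPerp (ℰ.rightPerp 𝒯) ⊓ 𝒳 = ℰ.coresolved (smd 𝒯) 𝒳 ⊓ 𝒳 ∧
      ℰ.coresolved (smd 𝒯) 𝒳 ⊓ 𝒳 = ℰ.coresolved (smd (𝒯 ⊓ 𝒳)) 𝒳 ⊓ 𝒳 := by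
  have h₁ : ℰ.coresolved (smd (𝒯 ⊓ 𝒳)) 𝒳 ⊓ 𝒳 ≤ ℰ.coresolved (smd 𝒯) 𝒳 ⊓ 𝒳 :=
    inf_le_inf_right 𝒳 (coresolved_mono (smd_mono inf_le_left))
  have h₂ : ℰ.coresolved (smd 𝒯) 𝒳 ⊓ 𝒳 ≤ ℰ.leftPerp (ℰ.rightPerp 𝒯) ⊓ 𝒳 :=
    inf_le_inf_right 𝒳 coresolved_smd_le_leftPerp
  have h₃ : ℰ.leftPerp (ℰ.rightPerp 𝒯) ⊓ 𝒳 ≤ ℰ.leftPerp (ℰ.rightPerp 𝒯 ⊓ 𝒳) ⊓ 𝒳 :=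
    inf_le_inf_right 𝒳 (leftPerp_anti inf_le_left)
  have h₄ : ℰ.leftPerp (ℰ.rightPerp 𝒯 ⊓ 𝒳) ⊓ 𝒳 ≤ ℰ.coresolved (smd (𝒯 ⊓ 𝒳)) 𝒳 ⊓ 𝒳 :=
    le_inf (hright.leftPerp_inf_le_coresolved hgen
      ((inf_le_left.trans le_leftPerp_rightPerp).trans (leftPerp_anti inf_le_left))) inf_le_right
  exact ⟨(h₄.trans (h₁.trans h₂)).antisymm h₃, (h₃.trans (h₄.trans h₁)).antisymm h₂,
    (h₂.trans (h₃.trans h₄)).antisymm h₁⟩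

end Approximation

end ExtriangulatedStructure

end Extri

open Extri ExtriangulatedStructure

theorem theorem3p18_general {C : Type u} [Category.{v} C] [Preadditive C] [HasZeroObject C]
    [HasBinaryBiproducts C] (ℰ : ExtriangulatedStructure.{w} C) (hW : ℰ.DeflationCancellation)
    (𝒳 𝒯 α : ObjectProperty C) (hsmd : 𝒳 = smd 𝒳) (hext : ℰ.ClosedUnderExtensions 𝒳)
    (hid : ∀ X : C, 𝒳 X → ℰ.injDimObj 𝒯 X < ⊤) (h2 : ℰ.T2 𝒳 𝒯) (h3 : ℰ.T3 𝒳 𝒯)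
    (hα : α ≤ ℰ.rightPerp 𝒯) (hcog : ℰ.IsRelativeCogenerator α 𝒳) (h5 : ℰ.T5 𝒳 𝒯) :
    (ℰ.leftPerp (ℰ.rightPerp 𝒯 ⊓ 𝒳) ⊓ 𝒳 = ℰ.leftPerp (ℰ.rightPerp 𝒯) ⊓ 𝒳 ∧
      ℰ.leftPerp (ℰ.rightPerp 𝒯) ⊓ 𝒳 = ℰ.coresolved (smd 𝒯) 𝒳 ⊓ 𝒳 ∧
      ℰ.coresolved (smd 𝒯) 𝒳 ⊓ 𝒳 = ℰ.coresolved (smd (𝒯 ⊓ 𝒳)) 𝒳 ⊓ 𝒳) ∧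
    (∀ k : ℕ, ℰ.projDim 𝒳 𝒯 ≤ k → ℰ.rightPerp 𝒯 ⊓ 𝒳 = ℰ.Fac 𝒳 𝒯 k ⊓ 𝒳) ∧
    ℰ.IsComplete 𝒳 (ℰ.leftPerp (ℰ.rightPerp 𝒯)) (ℰ.rightPerp 𝒯) ∧
    ℰ.IsHereditary (ℰ.leftPerp (ℰ.rightPerp 𝒯)) (ℰ.rightPerp 𝒯) := by
  have hgen : ℰ.IsRelativeGenerator (𝒯 ⊓ 𝒳) (ℰ.rightPerp 𝒯 ⊓ 𝒳) :=
    isRelativeGenerator_rightPerp hW hsmd hext h2 h3 h5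
  have hcor : ℰ.IsRightComplete 𝒳 (ℰ.coresolved (smd (𝒯 ⊓ 𝒳)) 𝒳) (ℰ.rightPerp 𝒯) :=
    isRightComplete_coresolved hsmd hext hid hgen hα hcog
  have hright : ℰ.IsRightComplete 𝒳 (ℰ.leftPerp (ℰ.rightPerp 𝒯)) (ℰ.rightPerp 𝒯) :=
    hcor.mono ((coresolved_mono (smd_mono inf_le_left)).trans coresolved_smd_le_leftPerp)
  have hleft : ℰ.IsLeftComplete 𝒳 (ℰ.leftPerp (ℰ.rightPerp 𝒯)) (ℰ.rightPerp 𝒯) := by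
    obtain ⟨ω, hω, hωgen⟩ := h3
    exact hright.isLeftComplete hext closedUnderExtensions_leftPerp
      (hω.trans (coresolved_le_leftPerp le_leftPerp_rightPerp)) hωgen
  exact ⟨leftPerp_rightPerp_inf_eq_coresolved_inf hgen hcor,
    fun k hk => rightPerp_inf_eq_fac_inf h2 hgen hk, ⟨hleft, hright⟩, isHereditary_leftPerp⟩

theorem theorem3p18 {C : Type u} [CategoryTheory.Category.{v} C] [CategoryTheory.Preadditive C]
    [CategoryTheory.Limits.HasZeroObject C] [CategoryTheory.Limits.HasBinaryBiproducts C]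
    (ℰ : Extri.ExtriangulatedStructure.{w} C) (hW : ℰ.DeflationCancellation)
    (𝒳 𝒯 : CategoryTheory.ObjectProperty C)
    (hsmd : 𝒳 = Extri.smd 𝒳) (hext : ℰ.ClosedUnderExtensions 𝒳)
    (n : ℕ) (h1 : ℰ.T1 n 𝒳 𝒯) (h2 : ℰ.T2 𝒳 𝒯) (h3 : ℰ.T3 𝒳 𝒯) (h4 : ℰ.T4 𝒳 𝒯)
    (h5 : ℰ.T5 𝒳 𝒯) :
    (𝒯 = Extri.smd 𝒯 →
      ℰ.leftPerp (ℰ.rightPerp 𝒯 ⊓ 𝒳) ⊓ 𝒳 = ℰ.leftPerp (ℰ.rightPerp 𝒯) ⊓ 𝒳 ∧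
      ℰ.leftPerp (ℰ.rightPerp 𝒯) ⊓ 𝒳 = ℰ.coresolved 𝒯 𝒳 ⊓ 𝒳 ∧
      ℰ.coresolved 𝒯 𝒳 ⊓ 𝒳 = ℰ.coresolved (𝒯 ⊓ 𝒳) 𝒳 ⊓ 𝒳) ∧
    (∀ k : ℕ, max 1 (ℰ.projDim 𝒳 𝒯) ≤ (k : ℕ∞) →
      ℰ.rightPerp 𝒯 ⊓ 𝒳 = ℰ.Fac 𝒳 𝒯 k ⊓ 𝒳) ∧
    (𝒯 = Extri.smd 𝒯 →
      ℰ.IsComplete 𝒳 (ℰ.leftPerp (ℰ.rightPerp 𝒯)) (ℰ.rightPerp 𝒯) ∧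
      ℰ.IsHereditary (ℰ.leftPerp (ℰ.rightPerp 𝒯)) (ℰ.rightPerp 𝒯)) := by
  obtain ⟨α, hα, hcog⟩ := h4
  have hid : ∀ X : C, 𝒳 X → ℰ.injDimObj 𝒯 X < ⊤ := fun X hX =>
    (injDimObj_le_of_projDim_le h1 hX).trans_lt (ENat.natCast_lt_top n)
  obtain ⟨hpart1, hpart2, hpart3⟩ :=
    theorem3p18_general ℰ hW 𝒳 𝒯 α hsmd hext hid h2 h3 (hα.trans inf_le_right) hcog h5
  refine ⟨fun hT => ?_, fun k hk => hpart2 k ((le_max_right _ _).trans hk), fun _ => hpart3⟩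
  rwa [smd_inf_eq hT hsmd, ← hT] at hpart1
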